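/- **Setting.** Let $A=(a_{ij})$ be a $5\times5$ complex upper-triangular matrix with diagonal entries $\lambda_i=a_{ii}=\alpha_i+\mathrm{i}\beta_i$ ($\alpha_i,\beta_i\in\mathbb R$). Let $p_A(x,y,z)=\det(x\,\mathrm{Re}A+y\,\mathrm{Im}A+zI_5)$, where $\mathrm{Re}A=(A+A^*)/2$ and $\mathrm{Im}A=(A-A^*)/(2\mathrm i)$. The Kippenhahn curve $C_R(A)$ is the real part (the points $a+\mathrm ib$ with $[a:b:1]$, $a,b\in\mathbb R$, on the curve) of the dual of the algebraic curve $p_A=0$ in $\mathbb{CP}^2$, its components being counted with multiplicity: each irreducible factor of $p_A$ contributes the real part of its dual curve as often as it divides $p_A$. An ellipse with foci $u,v$ and minor axis of length $r>0$ is the curve $\{\zeta\in\mathbb C:|\zeta-u|+|\zeta-v|=\sqrt{r^2+|u-v|^2}\}$; for $r=0$ it degenerates into the two points $u$ and $v$. **Notation.** $S_{i_1\dots i_n}$ under a sum means that the sum runs over indices in $\{1,\dots,5\}$ with $i_1<\dots<i_n$; if several $S$'s stand under a sum, all these conditions hold, and differently named indices (including, in $P_i$, the given $i$) take different values. For $i=1,\dots,5$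 put $$P_i=\sum_{S_{jkm}S_{lm}}|a_{jk}|^2|a_{lm}|^2-\sum_{S_{jkl}S_{jml}}\Re(a_{jk}a_{kl}\overline{a_{jm}}\,\overline{a_{ml}})-\sum_{S_{jk}S_{lkm}}\Re(a_{jk}a_{lm}\overline{a_{jm}}\,\overline{a_{lk}}).$$ **Theorem.** Let $p,q,t,v,w$ be the numbers $1,\dots,5$ in some order and let $r,s\ge0$. Then $C_R(A)$ consists of two ellipses, one with foci $\lambda_p,\lambda_q$ and minor axis of length $r$, the other with foci $\lambda_t,\lambda_v$ and minor axis of length $s$, and the point $\lambda_w$ (components counted with multiplicity) if and only if all of the following hold: (a) $r^2+s^2=\sum_{S_{lm}}|a_{lm}|^2$. (b) $r^2(\lambda_w+\lambda_t+\lambda_v)+s^2(\lambda_w+\lambda_q+\lambda_p)=\sum_{S_{ijk}S_{lm}}|a_{lm}|^2(\lambda_i+\lambda_j+\lambda_k)-\sum_{S_{klm}}a_{kl}a_{lm}\overline{a_{km}}$. (c) $r^2(\lambda_w\lambda_v+\lambda_w\lambda_t+\lambda_t\lambda_v)+s^2(\lambda_w\lambda_p+\lambda_w\lambda_q+\lambda_p\lambda_q)=\sum_{S_{ijk}S_{lm}}|a_{lm}|^2(\lambda_i\lambda_j+\lambda_i\lambda_k+\lambda_j\lambda_k)-\sum_{S_{ij}S_{klm}}(\lambda_i+\lambda_j)a_{kl}a_{lm}\overline{a_{km}}+\sum_{S_{jklm}}a_{jk}a_{kl}a_{lm}\overline{a_{jm}}$.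 (d) $r^2\lambda_w\lambda_t\lambda_v+s^2\lambda_w\lambda_p\lambda_q=\sum_{S_{ijk}S_{lm}}|a_{lm}|^2\lambda_i\lambda_j\lambda_k-\sum_{S_{ij}S_{klm}}\lambda_i\lambda_ja_{kl}a_{lm}\overline{a_{km}}+\sum_{S_iS_{jklm}}a_{jk}a_{kl}a_{lm}\overline{a_{jm}}\lambda_i-a_{12}a_{23}a_{34}a_{45}\overline{a_{15}}$. (e) $r^2\alpha_w\alpha_t\alpha_v+s^2\alpha_w\alpha_p\alpha_q-\frac{r^2s^2}{4}\alpha_w=\sum_{S_{ijk}S_{lm}}|a_{lm}|^2\alpha_i\alpha_j\alpha_k-\sum_{S_{ij}S_{klm}}\Re(a_{kl}a_{lm}\overline{a_{km}})\alpha_i\alpha_j-\frac14\sum_{i=1}^5P_i\alpha_i+\frac12\sum_{S_iS_{jklm}}\Re(a_{jk}a_{kl}a_{lm}\overline{a_{jm}})\alpha_i+\frac14\sum_{S_{ij}S_{klm}}\Re(a_{kl}a_{lm}\overline{a_{km}})|a_{ij}|^2-\frac14\sum_{S_{ijkl}S_{iml}}\Re(a_{ij}a_{jk}a_{kl}\overline{a_{im}}\,\overline{a_{ml}})-\frac14\sum_{S_{ijk}S_{lm}S_{im}S_{lk}}\Re(a_{ij}a_{jk}a_{lm}\overline{a_{im}}\,\overline{a_{lk}})-\frac14\Re(a_{12}a_{23}a_{34}a_{45}\overline{a_{15}})$.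 (f) $r^2\beta_w\beta_t\beta_v+s^2\beta_w\beta_p\beta_q-\frac{r^2s^2}{4}\beta_w=\sum_{S_{ijk}S_{lm}}|a_{lm}|^2\beta_i\beta_j\beta_k-\sum_{S_{ij}S_{klm}}\Im(a_{kl}a_{lm}\overline{a_{km}})\beta_i\beta_j-\frac14\sum_{i=1}^5P_i\beta_i-\frac12\sum_{S_iS_{jklm}}\Re(a_{jk}a_{kl}a_{lm}\overline{a_{jm}})\beta_i+\frac14\sum_{S_{ij}S_{klm}}\Im(a_{kl}a_{lm}\overline{a_{km}})|a_{ij}|^2-\frac14\sum_{S_{ijkl}S_{iml}}\Im(a_{ij}a_{jk}a_{kl}\overline{a_{im}}\,\overline{a_{ml}})-\frac14\sum_{S_{ijk}S_{lm}S_{im}S_{lk}}\Im(a_{ij}a_{jk}a_{lm}\overline{a_{im}}\,\overline{a_{lk}})+\frac14\Im(a_{12}a_{23}a_{34}a_{45}\overline{a_{15}})$. (g) $r^2(\alpha_w\alpha_t+\alpha_w\alpha_v+\alpha_v\alpha_t)+s^2(\alpha_w\alpha_p+\alpha_w\alpha_q+\alpha_p\alpha_q)-\frac{r^2s^2}{4}=\sum_{S_{ijk}S_{lm}}|a_{lm}|^2(\alpha_i\alpha_j+\alpha_i\alpha_k+\alpha_j\alpha_k)-\sum_{S_{ij}S_{klm}}\Re(a_{kl}a_{lm}\overline{a_{km}})(\alpha_i+\alpha_j)-\frac14\sum_{i=1}^5P_i+\frac12\sum_{S_{jklm}}\Re(a_{jk}a_{kl}a_{lm}\overline{a_{jm}})$.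 -/

import Mathlib

open scoped ComplexConjugate BigOperators

noncomputable section

/-- The Kippenhahn polynomial `det (x Re A + y Im A + z I)`, a form of degree `n` in the
variables `x = X 0`, `y = X 1`, `z = X 2`, where `Re A = (A + A*) / 2` and
`Im A = (A - A*) / (2 i)`. -/
def kippenhahnPoly {n : ℕ} (A : Matrix (Fin n) (Fin n) ℂ) : MvPolynomial (Fin 3) ℂ :=
  Matrix.det
    ((MvPolynomial.X 0 : MvPolynomial (Fin 3) ℂ) •
        (((1 / 2 : ℂ) • (A + A.conjTranspose)).map MvPolynomial.C)
      + (MvPolynomial.X 1 : MvPolynomial (Fin 3) ℂ) •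
        (((1 / (2 * Complex.I) : ℂ) • (A - A.conjTranspose)).map MvPolynomial.C)
      + (MvPolynomial.X 2 : MvPolynomial (Fin 3) ℂ) •
        (1 : Matrix (Fin n) (Fin n) (MvPolynomial (Fin 3) ℂ)))

/-- The line coordinates (up to scaling) of the tangent lines of the projective plane curve
`f = 0` at its smooth points: the nonzero gradients of `f` at zeros of `f`. -/
def tangentLines (f : MvPolynomial (Fin 3) ℂ) : Set (Fin 3 → ℂ) :=
  {ξ | ξ ≠ 0 ∧ ∃ P : Fin 3 → ℂ, P ≠ 0 ∧ MvPolynomial.eval P f = 0 ∧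
    ∀ i, ξ i = MvPolynomial.eval P (MvPolynomial.pderiv i f)}

/-- The dual curve of `f = 0`, in homogeneous line coordinates: the Zariski closure, in the dual
projective plane, of the set of the tangent lines at smooth points. -/
def dualCurve (f : MvPolynomial (Fin 3) ℂ) : Set (Fin 3 → ℂ) :=
  {ξ | ξ ≠ 0 ∧ ∀ (g : MvPolynomial (Fin 3) ℂ) (d : ℕ), g.IsHomogeneous d →
    (∀ η ∈ tangentLines f, MvPolynomial.eval η g = 0) → MvPolynomial.eval ξ g = 0}

/-- The real points `[a : b : 1]` of the dual curve of `f = 0`, seen as the points `a + i b` of the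
complex plane. -/
def realDual (f : MvPolynomial (Fin 3) ℂ) : Set ℂ :=
  {ζ | ![(ζ.re : ℂ), (ζ.im : ℂ), 1] ∈ dualCurve f}

/-- The real Kippenhahn curve `C_R(A)`: the real part of the dual of the curve `p_A = 0`, given as
the multiset of its components. Each irreducible factor of `p_A` contributes the real part of its
dual curve, as often as it divides `p_A`. (Duals and real parts do not depend on the choice of the
factors up to nonzero constants.) -/
def kippenhahnCurve {n : ℕ} (A : Matrix (Fin n) (Fin n) ℂ) : Multiset (Set ℂ) :=
  (UniqueFactorizationMonoid.factors (kippenhahnPoly A)).map realDual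

/-- The ellipse (a curve, not a disc) with foci `u`, `v` and minor axis of length `r`; its major
axis has length `√(r² + |u - v|²)`. -/
def ellipseSet (u v : ℂ) (r : ℝ) : Set ℂ :=
  {ζ | dist ζ u + dist ζ v = Real.sqrt (r ^ 2 + dist u v ^ 2)}

open scoped Classical in
/-- The ellipse with foci `u`, `v` and minor axis of length `r ≥ 0`, as a multiset of components:
one component if `r > 0`; for `r = 0` the ellipse degenerates into its two foci. -/
def ellipseCurve (u v : ℂ) (r : ℝ) : Multiset (Set ℂ) :=
  if r = 0 then {{u}, {v}} else {ellipseSet u v r}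

/-- A point as a curve with one component. -/
def pointCurve (u : ℂ) : Multiset (Set ℂ) := {{u}}

end

/-- `(i, j, k, l, m)` pairwise distinct with `i < j < k` and `l < m`. -/
def S_ijk_lm : Finset (Fin 5 × Fin 5 × Fin 5 × Fin 5 × Fin 5) :=
  Finset.univ.filter fun (i, j, k, l, m) => [i, j, k, l, m].Nodup ∧ i < j ∧ j < k ∧ l < m

/-- `(i, j, k, l, m)` pairwise distinct with `i < j` and `k < l < m`. -/
def S_ij_klm : Finset (Fin 5 × Fin 5 × Fin 5 × Fin 5 × Fin 5) :=
  Finset.univ.filter fun (i, j, k, l, m) => [i, j, k, l, m].Nodup ∧ i < j ∧ k < l ∧ l < m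

/-- `(i, j, k, l, m)` pairwise distinct with `j < k < l < m`. -/
def S_i_jklm : Finset (Fin 5 × Fin 5 × Fin 5 × Fin 5 × Fin 5) :=
  Finset.univ.filter fun (i, j, k, l, m) => [i, j, k, l, m].Nodup ∧ j < k ∧ k < l ∧ l < m

/-- `(i, j, k, l, m)` pairwise distinct with `i < j < k < l` and `i < m < l`. -/
def S_ijkl_iml : Finset (Fin 5 × Fin 5 × Fin 5 × Fin 5 × Fin 5) :=
  Finset.univ.filter fun (i, j, k, l, m) =>
    [i, j, k, l, m].Nodup ∧ i < j ∧ j < k ∧ k < l ∧ i < m ∧ m < l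

/-- `(i, j, k, l, m)` pairwise distinct with `i < j < k`, `l < m`, `i < m` and `l < k`. -/
def S_ijk_lm_im_lk : Finset (Fin 5 × Fin 5 × Fin 5 × Fin 5 × Fin 5) :=
  Finset.univ.filter fun (i, j, k, l, m) =>
    [i, j, k, l, m].Nodup ∧ i < j ∧ j < k ∧ l < m ∧ i < m ∧ l < k

/-- `(l, m)` with `l < m`. -/
def S_lm : Finset (Fin 5 × Fin 5) :=
  Finset.univ.filter fun (l, m) => l < m

/-- `(k, l, m)` with `k < l < m`. -/
def S_klm : Finset (Fin 5 × Fin 5 × Fin 5) :=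
  Finset.univ.filter fun (k, l, m) => k < l ∧ l < m

/-- `(j, k, l, m)` with `j < k < l < m`. -/
def S_jklm : Finset (Fin 5 × Fin 5 × Fin 5 × Fin 5) :=
  Finset.univ.filter fun (j, k, l, m) => j < k ∧ k < l ∧ l < m

/-- For a fixed `i`: `(j, k, l, m)`, with `i, j, k, l, m` pairwise distinct, `j < k < m`
and `l < m`. -/
def S_jkm_lm (i : Fin 5) : Finset (Fin 5 × Fin 5 × Fin 5 × Fin 5) :=
  Finset.univ.filter fun (j, k, l, m) => [i, j, k, l, m].Nodup ∧ j < k ∧ k < m ∧ l < m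

/-- For a fixed `i`: `(j, k, l, m)`, with `i, j, k, l, m` pairwise distinct, `j < k < l`
and `j < m < l`. -/
def S_jkl_jml (i : Fin 5) : Finset (Fin 5 × Fin 5 × Fin 5 × Fin 5) :=
  Finset.univ.filter fun (j, k, l, m) => [i, j, k, l, m].Nodup ∧ j < k ∧ k < l ∧ j < m ∧ m < l

/-- For a fixed `i`: `(j, k, l, m)`, with `i, j, k, l, m` pairwise distinct, `j < k`
and `l < k < m`. -/
def S_jk_lkm (i : Fin 5) : Finset (Fin 5 × Fin 5 × Fin 5 × Fin 5) :=
  Finset.univ.filter fun (j, k, l, m) => [i, j, k, l, m].Nodup ∧ j < k ∧ l < k ∧ k < m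

noncomputable section

/-- The real numbers `P_i` attached to the strictly upper triangular entries of `A`. -/
def entryP (A : Matrix (Fin 5) (Fin 5) ℂ) (i : Fin 5) : ℝ :=
  (∑ ⟨j, k, l, m⟩ ∈ S_jkm_lm i, ‖A j k‖ ^ 2 * ‖A l m‖ ^ 2)
    - (∑ ⟨j, k, l, m⟩ ∈ S_jkl_jml i, (A j k * A k l * conj (A j m) * conj (A m l)).re)
    - ∑ ⟨j, k, l, m⟩ ∈ S_jk_lkm i, (A j k * A l m * conj (A j m) * conj (A l k)).re

end

/-!
The statement splits into a geometric and an algebraic equivalence, with the product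
`T = E₁ * E₂ * L` in between, where `L = L_w` for `L_u = x Re u + y Im u + z` (`lineForm`), and
`E = L_u L_v - (r² / 4) (x² + y²)` (`ellipseForm`) is the Kippenhahn polynomial of a `2 × 2` matrix
with eigenvalues `u`, `v`.

The geometric part (`kippenhahnCurve_eq_iff`) says that the curve has the prescribed components if
and only if `p_A = T`. The dual of `L_u` is the point `u`. For `r > 0`, an affine frame of the
ellipse (`EllipseFrame`) turns `E` into `z² - x² - y²`; hence `E` is irreducible, and the real part
of its dual is the ellipse. This and unique factorization give one direction. For the other, every
irreducible factor of `p_A` is a form with the same real dual as one of the prescribed factors. A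
line has at most one real dual point, so the degree of the factor is at least the prescribed one;
the degrees add up to `5` on both sides, hence they agree. Finally, a linear form is determined by
its dual point, and a conic whose real dual is an ellipse is determined by five points of it, up to
constants, which are fixed by the coefficient of `z⁵`.

The algebraic part (`pencil_det_eq_iff`) says that `p_A = T` if and only if the seven equations
hold. In the coordinates `X = (x - i y) / 2`, `Y = (x + i y) / 2` the polynomial `p_A` is
`det (X A + Y A* + z)`. As `A` is triangular, both `p_A` and `T` are congruent modulo `X Y` to the
product of the `z + λ_i X + conj λ_i Y`, so `p_A - T = X Y Q` for a cubic form `Q`, whose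
coefficients are computed in `det_pencil`. Two of the ten coefficients of `Q`, those of `z³` and
`X Y z`, are real, and the others form conjugate pairs.
The first four equations are the vanishing of those of `z³`, `X z²`, `X² z` and `X³`. The last
three are the vanishing of the coefficients of `x³`, `y³` and `x² z` in the real coordinates; given
the others, these amount to the vanishing of the coefficients of `X² Y` and `X Y z`.
-/

/-! ### Forms of low degree -/

section Homogeneous

open MvPolynomial

variable {σ R : Type*} [CommRing R]

/-- The substitution `X i ↦ X i * T` for a new variable `T`. The coefficients of the image, as a
polynomial in `T`, are the homogeneous components. -/
noncomputable def gradingHom : MvPolynomial σ R →ₐ[R] Polynomial (MvPolynomial σ R) :=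
  aeval fun i => Polynomial.C (X i) * Polynomial.X

lemma gradingHom_coeff (f : MvPolynomial σ R) (k : ℕ) :
    (gradingHom f).coeff k = homogeneousComponent k f := by
  induction f using MvPolynomial.induction_on' with
  | monomial d c =>
    have h : gradingHom (monomial d c) =
        Polynomial.C (monomial d c) * Polynomial.X ^ d.degree := by
      rw [gradingHom, aeval_monomial, Finsupp.prod]
      simp only [mul_pow, Finset.prod_mul_distrib, ← Polynomial.C_pow, ← map_prod]
      rw [Finset.prod_pow_eq_pow_sum, ← mul_assoc]
      congr 1
      rw [monomial_eq, map_mul]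
      rfl
    rw [h, Polynomial.coeff_C_mul_X_pow]
    split_ifs with hk
    · subst hk
      exact (homogeneousComponent_eq_self
        ((mem_homogeneousSubmodule _ _).2 (isHomogeneous_monomial c rfl))).symm
    · rw [homogeneousComponent_of_mem (n := d.degree)
        ((mem_homogeneousSubmodule _ _).2 (isHomogeneous_monomial c rfl)), if_neg hk]
  | add p q hp hq => simp [hp, hq]

lemma gradingHom_of_isHomogeneous {f : MvPolynomial σ R} {n : ℕ} (hf : f.IsHomogeneous n) :
    gradingHom f = Polynomial.C f * Polynomial.X ^ n := by
  ext1 k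
  rw [gradingHom_coeff, Polynomial.coeff_C_mul_X_pow, homogeneousComponent_of_mem
    (n := n) ((mem_homogeneousSubmodule _ _).2 hf)]

/-- Over a domain, the factors of a form are forms: the degree and the trailing degree in `T` of
the image under `gradingHom` are both additive, and they agree for the product. -/
theorem isHomogeneous_of_mul [IsDomain R] {f g : MvPolynomial σ R} {n : ℕ}
    (h : (f * g).IsHomogeneous n) (h0 : f * g ≠ 0) : f.IsHomogeneous f.totalDegree := by
  have hinj : ∀ u : MvPolynomial σ R, u ≠ 0 → gradingHom u ≠ 0 := by
    intro u hu h'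
    apply hu
    rw [← sum_homogeneousComponent u]
    refine Finset.sum_eq_zero fun k _ => ?_
    rw [← gradingHom_coeff, h', Polynomial.coeff_zero]
  have hf := hinj f (left_ne_zero_of_mul h0)
  have hg := hinj g (right_ne_zero_of_mul h0)
  have hm : gradingHom f * gradingHom g = Polynomial.C (f * g) * Polynomial.X ^ n := by
    rw [← map_mul, gradingHom_of_isHomogeneous h]
  have h1 := congrArg Polynomial.natDegree hm
  have h2 := congrArg Polynomial.natTrailingDegree hm
  rw [Polynomial.natDegree_mul hf hg, Polynomial.natDegree_C_mul_X_pow _ _ h0] at h1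
  rw [Polynomial.natTrailingDegree_mul hf hg, Polynomial.C_mul_X_pow_eq_monomial,
    Polynomial.natTrailingDegree_monomial h0] at h2
  have h3 := Polynomial.natTrailingDegree_le_natDegree (gradingHom f)
  have h4 := Polynomial.natTrailingDegree_le_natDegree (gradingHom g)
  have hk : f.IsHomogeneous (gradingHom f).natDegree := by
    intro d hd
    rw [Pi.one_def, ← Finsupp.degree_eq_weight_one]
    have hc : (gradingHom f).coeff d.degree ≠ 0 := by
      rw [gradingHom_coeff]
      intro h'
      apply hd
      rw [← coeff_zero d, ← h', coeff_homogeneousComponent, if_pos rfl]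
    have := Polynomial.le_natDegree_of_ne_zero hc
    have := Polynomial.natTrailingDegree_le_of_ne_zero hc
    omega
  rwa [hk.totalDegree (left_ne_zero_of_mul h0)]

lemma eval_smul_of_isHomogeneous {f : MvPolynomial σ R} {n : ℕ} (hf : f.IsHomogeneous n)
    (t : R) (P : σ → R) : eval (t • P) f = t ^ n * eval P f := by
  rw [eval_eq, eval_eq, Finset.mul_sum]
  refine Finset.sum_congr rfl fun d hd => ?_
  simp only [Pi.smul_apply, smul_eq_mul, mul_pow, Finset.prod_mul_distrib]
  rw [Finset.prod_pow_eq_pow_sum, ← hf.degree_eq_sum_deg_support hd]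
  ring

lemma pderiv_comm (i j : σ) (f : MvPolynomial σ R) :
    pderiv i (pderiv j f) = pderiv j (pderiv i f) := by
  classical
  have h : ⁅pderiv (R := R) i, pderiv j⁆ =
      (0 : Derivation R (MvPolynomial σ R) (MvPolynomial σ R)) := by
    refine derivation_ext fun k => ?_
    rw [Derivation.commutator_apply]
    simp [pderiv_X, Pi.single_apply, apply_ite]
  have h' := congrArg (fun D => D f) h
  simp only [Derivation.commutator_apply, Derivation.zero_apply] at h'
  exact sub_eq_zero.1 h'

variable [Fintype σ]

lemma exists_eq_sum_of_isHomogeneous_one {f : MvPolynomial σ R} (hf : f.IsHomogeneous 1) :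
    ∃ c : σ → R, f = ∑ i, X i * C (c i) := by
  have h : ∀ i, ∃ c, pderiv i f = C c := fun i =>
    ⟨_, totalDegree_eq_zero_iff_eq_C.1 (Nat.le_zero.1 (hf.pderiv (i := i)).totalDegree_le)⟩
  choose c hc using h
  refine ⟨c, ?_⟩
  have := hf.sum_X_mul_pderiv
  simp only [hc, one_smul] at this
  exact this.symm

/-- A quadratic form is determined by its Hessian, a symmetric matrix; its gradient is the linear
map of the Hessian. -/
lemma exists_hessian {f : MvPolynomial σ R} (hf : f.IsHomogeneous 2) :
    ∃ H : Matrix σ σ R, H.IsSymm ∧ (∀ P i, eval P (pderiv i f) = (H.mulVec P) i) ∧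
      ∀ P, 2 * eval P f = dotProduct P (H.mulVec P) := by
  have h : ∀ i, ∃ c : σ → R, pderiv i f = ∑ j, X j * C (c j) := fun i =>
    exists_eq_sum_of_isHomogeneous_one hf.pderiv
  choose H hH using h
  have hcoeff : ∀ i j, pderiv j (pderiv i f) = C (H i j) := by
    classical
    intro i j
    rw [hH, map_sum, Finset.sum_eq_single j]
    · simp [pderiv_X]
    · intro k _ hk
      simp [pderiv_X, hk]
    · simp
  have hgrad : ∀ P i, eval P (pderiv i f) = ((Matrix.of H).mulVec P) i := by
    intro P i
    simp [hH, Matrix.mulVec, dotProduct, mul_comm]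
  refine ⟨Matrix.of H, ?_, hgrad, fun P => ?_⟩
  · ext i j
    apply C_injective σ R
    rw [Matrix.transpose_apply, Matrix.of_apply, Matrix.of_apply, ← hcoeff, ← hcoeff, pderiv_comm]
  · have := congrArg (eval P) hf.sum_X_mul_pderiv
    simp only [map_sum, map_mul, eval_X, hgrad, nsmul_eq_mul] at this
    simpa [dotProduct] using this.symm

end Homogeneous

/-! ### Duals of lines and conics -/

section Duals

open MvPolynomial

lemma dualCurve_subset {f g : MvPolynomial (Fin 3) ℂ} {c : ℂ} (hc : c ≠ 0)
    (h : ∀ ξ ∈ tangentLines f, c • ξ ∈ tangentLines g) : dualCurve f ⊆ dualCurve g := by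
  rintro ξ ⟨h0, hξ⟩
  refine ⟨h0, fun G d hG hv => hξ G d hG fun η hη => ?_⟩
  have := hv _ (h η hη)
  rw [eval_smul_of_isHomogeneous hG] at this
  exact (mul_eq_zero.1 this).resolve_left (pow_ne_zero _ hc)

lemma realDual_eq_of_associated {f g : MvPolynomial (Fin 3) ℂ} (h : Associated f g) :
    realDual f = realDual g := by
  have key : ∀ f g : MvPolynomial (Fin 3) ℂ, Associated f g → dualCurve f ⊆ dualCurve g := by
    rintro f _ ⟨u, rfl⟩
    obtain ⟨c, hc, hu⟩ := isUnit_iff_eq_C_of_isReduced.1 u.isUnit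
    refine dualCurve_subset hc.ne_zero ?_
    rintro ξ ⟨h0, P, hP, hf, hg⟩
    refine ⟨smul_ne_zero hc.ne_zero h0, P, hP, by simp [hf], fun i => ?_⟩
    rw [hu, mul_comm f, pderiv_C_mul]
    simp [hg]
  have : dualCurve f = dualCurve g := (key f g h).antisymm (key g f h.symm)
  simp [realDual, this]

lemma exists_dotProduct_eq_zero (c : Fin 3 → ℂ) : ∃ P : Fin 3 → ℂ, P ≠ 0 ∧ ∑ i, P i * c i = 0 := by
  by_cases h : c 0 = 0
  · exact ⟨![1, 0, 0], fun h' => by simpa using congrFun h' 0, by simp [Fin.sum_univ_three, h]⟩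
  · exact ⟨![c 1, -c 0, 0], fun h' => h (by simpa using congrFun h' 1),
      by simp [Fin.sum_univ_three]; ring⟩

/-- The dual of a line is a point. -/
lemma mem_dualCurve_linear {c : Fin 3 → ℂ} (hc : c ≠ 0) (ξ : Fin 3 → ℂ) :
    ξ ∈ dualCurve (∑ i, X i * C (c i)) ↔ ξ ≠ 0 ∧ ∃ t : ℂ, ξ = t • c := by
  have hgrad : ∀ P i, eval P (pderiv i (∑ i, X i * C (c i))) = c i := by
    intro P i
    rw [map_sum, Finset.sum_eq_single i]
    · simp
    · intro j _ hj
      simp [pderiv_X, hj]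
    · simp
  have hmem : c ∈ tangentLines (∑ i, X i * C (c i)) := by
    obtain ⟨P, hP, h⟩ := exists_dotProduct_eq_zero c
    exact ⟨hc, P, hP, by simpa using h, fun i => (hgrad P i).symm⟩
  refine and_congr_right fun h0 => ⟨fun h => ?_, ?_⟩
  · obtain ⟨k, hk⟩ := Function.ne_iff.1 hc
    refine ⟨ξ k / c k, funext fun j => ?_⟩
    have := h (C (c k) * X j - C (c j) * X k) 1
      ((isHomogeneous_C_mul_X _ _).sub (isHomogeneous_C_mul_X _ _)) ?_
    · simp only [map_sub, map_mul, eval_C, eval_X] at this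
      simp only [Pi.smul_apply, smul_eq_mul]
      have hk' : c k ≠ 0 := hk
      field_simp
      linear_combination this
    · rintro η ⟨_, P, _, _, hη⟩
      simp only [hgrad] at hη
      simp [hη]
      ring
  · rintro ⟨t, rfl⟩ G d hG hv
    rw [eval_smul_of_isHomogeneous hG, hv _ hmem, mul_zero]

/-- The dual of a conic with an invertible Hessian `H` is the conic of `H⁻¹`. -/
lemma mem_dualCurve_quadric {f : MvPolynomial (Fin 3) ℂ} {H : Matrix (Fin 3) (Fin 3) ℂ}
    (hgrad : ∀ P i, eval P (pderiv i f) = (H.mulVec P) i)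
    (heval : ∀ P, 2 * eval P f = dotProduct P (H.mulVec P)) (hdet : IsUnit H.det)
    (ξ : Fin 3 → ℂ) :
    ξ ∈ dualCurve f ↔ ξ ≠ 0 ∧ dotProduct ξ (H⁻¹.mulVec ξ) = 0 := by
  have hinv : ∀ P, H⁻¹.mulVec (H.mulVec P) = P := fun P => by
    rw [Matrix.mulVec_mulVec, Matrix.nonsing_inv_mul _ hdet, Matrix.one_mulVec]
  have hinv' : ∀ P, H.mulVec (H⁻¹.mulVec P) = P := fun P => by
    rw [Matrix.mulVec_mulVec, Matrix.mul_nonsing_inv _ hdet, Matrix.one_mulVec]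
  refine and_congr_right fun h0 => ⟨fun h => ?_, fun h G d _ hv => ?_⟩
  · have hG : (∑ i, ∑ j, C (H⁻¹ i j) * X i * X j : MvPolynomial (Fin 3) ℂ).IsHomogeneous 2 :=
      IsHomogeneous.sum _ _ _ fun i _ => IsHomogeneous.sum _ _ _ fun j _ =>
        (isHomogeneous_C_mul_X _ _).mul (isHomogeneous_X _ _)
    have hGe : ∀ η, eval η (∑ i, ∑ j, C (H⁻¹ i j) * X i * X j : MvPolynomial (Fin 3) ℂ) =
        dotProduct η (H⁻¹.mulVec η) := by
      intro η
      simp only [map_sum, map_mul, eval_C, eval_X, dotProduct, Matrix.mulVec, Finset.mul_sum]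
      exact Finset.sum_congr rfl fun i _ => Finset.sum_congr rfl fun j _ => by ring
    rw [← hGe]
    refine h _ 2 hG ?_
    rintro η ⟨_, P, _, hP, hη⟩
    have : η = H.mulVec P := funext fun i => by rw [hη, hgrad]
    rw [hGe, this, hinv, dotProduct_comm, ← heval, hP, mul_zero]
  · refine hv ξ ⟨h0, H⁻¹.mulVec ξ, fun h' => h0 ?_, ?_, fun i => ?_⟩
    · rw [← hinv' ξ, h', Matrix.mulVec_zero]
    · have := heval (H⁻¹.mulVec ξ)
      rw [hinv', dotProduct_comm, h] at this
      simpa using this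
    · rw [hgrad, hinv']

/-- The dual of a conic with a singular point lies in the dual line of that point. -/
lemma dotProduct_eq_zero_of_mem_dualCurve {f : MvPolynomial (Fin 3) ℂ}
    {H : Matrix (Fin 3) (Fin 3) ℂ} (hsymm : H.IsSymm)
    (hgrad : ∀ P i, eval P (pderiv i f) = (H.mulVec P) i) {k : Fin 3 → ℂ}
    (hk : H.mulVec k = 0) {ξ : Fin 3 → ℂ} (hξ : ξ ∈ dualCurve f) : dotProduct k ξ = 0 := by
  have hG : (∑ i, C (k i) * X i : MvPolynomial (Fin 3) ℂ).IsHomogeneous 1 :=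
    IsHomogeneous.sum _ _ _ fun i _ => isHomogeneous_C_mul_X _ _
  have hGe : ∀ η, eval η (∑ i, C (k i) * X i : MvPolynomial (Fin 3) ℂ) = dotProduct k η := by
    intro η
    simp [dotProduct]
  rw [← hGe]
  refine hξ.2 _ 1 hG ?_
  rintro η ⟨_, P, _, _, hη⟩
  have : η = H.mulVec P := funext fun i => by rw [hη, hgrad]
  rw [hGe, this, Matrix.dotProduct_mulVec, ← Matrix.mulVec_transpose, hsymm.eq, hk,
    zero_dotProduct]

/-- The Kippenhahn polynomial of the `1 × 1` matrix `u`; its dual is the point `u`. -/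
noncomputable def lineForm (u : ℂ) : MvPolynomial (Fin 3) ℂ :=
  ∑ i, X i * C ((![(u.re : ℂ), (u.im : ℂ), 1] : Fin 3 → ℂ) i)

lemma coords_ne_zero (u : ℂ) : (![(u.re : ℂ), (u.im : ℂ), 1] : Fin 3 → ℂ) ≠ 0 :=
  fun h => by simpa using congrFun h 2

lemma eq_of_coords_eq_smul {u ζ t : ℂ}
    (h : (![(ζ.re : ℂ), (ζ.im : ℂ), 1] : Fin 3 → ℂ) = t • ![(u.re : ℂ), (u.im : ℂ), 1]) :
    ζ = u := by
  have h2 : t = 1 := by simpa using (congrFun h 2).symm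
  subst h2
  have h0 : (ζ.re : ℂ) = u.re := by simpa using congrFun h 0
  have h1 : (ζ.im : ℂ) = u.im := by simpa using congrFun h 1
  exact Complex.ext (by exact_mod_cast h0) (by exact_mod_cast h1)

lemma realDual_lineForm (u : ℂ) : realDual (lineForm u) = {u} := by
  ext ζ
  change _ ∈ dualCurve (lineForm u) ↔ _
  rw [lineForm, mem_dualCurve_linear (coords_ne_zero u)]
  constructor
  · rintro ⟨-, t, ht⟩
    exact eq_of_coords_eq_smul ht
  · rintro rfl
    exact ⟨coords_ne_zero _, 1, (one_smul _ _).symm⟩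

lemma realDual_subsingleton_of_isHomogeneous_one {f : MvPolynomial (Fin 3) ℂ}
    (hf : f.IsHomogeneous 1) (h0 : f ≠ 0) : (realDual f).Subsingleton := by
  obtain ⟨c, rfl⟩ := exists_eq_sum_of_isHomogeneous_one hf
  have hc : c ≠ 0 := by
    rintro rfl
    simp at h0
  intro u hu ζ hζ
  obtain ⟨-, t, ht⟩ := (mem_dualCurve_linear hc _).1 hu
  obtain ⟨-, t', ht'⟩ := (mem_dualCurve_linear hc _).1 hζ
  have h1 : t * c 2 = 1 := by simpa using (congrFun ht 2).symm
  have htc : t ≠ 0 := left_ne_zero_of_mul_eq_one h1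
  refine (eq_of_coords_eq_smul (t := t' / t) ?_).symm
  rw [ht, ht', smul_smul, div_mul_cancel₀ _ htc]

lemma isUnit_of_totalDegree_eq_zero {f : MvPolynomial (Fin 3) ℂ} (hf : f ≠ 0)
    (h : f.totalDegree = 0) : IsUnit f := by
  rw [totalDegree_eq_zero_iff_eq_C] at h
  rw [h]
  refine (isUnit_iff_ne_zero.2 fun h' => hf ?_).map C
  rw [h, h', C_0]

lemma associated_of_eval_eq {f g : MvPolynomial (Fin 3) ℂ} {c : ℂ} (hc : c ≠ 0)
    (h : ∀ P, eval P g = c * eval P f) : Associated f g := by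
  have : g = f * C c := funext fun P => by rw [h, map_mul, eval_C, mul_comm]
  rw [this]
  exact associated_mul_unit_right _ _ ((isUnit_iff_ne_zero.2 hc).map C)

lemma associated_lineForm {f : MvPolynomial (Fin 3) ℂ} (hf : f.IsHomogeneous 1) (h0 : f ≠ 0)
    {u : ℂ} (hu : u ∈ realDual f) : Associated f (lineForm u) := by
  obtain ⟨c, rfl⟩ := exists_eq_sum_of_isHomogeneous_one hf
  have hc : c ≠ 0 := by
    rintro rfl
    simp at h0
  obtain ⟨-, t, ht⟩ := (mem_dualCurve_linear hc _).1 hu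
  have h1 : t * c 2 = 1 := by simpa using (congrFun ht 2).symm
  have ht0 : t ≠ 0 := left_ne_zero_of_mul_eq_one h1
  refine associated_of_eval_eq ht0 fun P => ?_
  rw [lineForm, ht]
  simp only [map_sum, map_mul, eval_X, eval_C, Finset.mul_sum, Pi.smul_apply, smul_eq_mul]
  exact Finset.sum_congr rfl fun i _ => by ring

end Duals

/-! ### Ellipses -/

section Ellipses

open MvPolynomial

/-- The Kippenhahn polynomial of the `2 × 2` matrix with diagonal entries `u`, `v` and
off-diagonal entries `r`, `0`. -/
noncomputable def ellipseForm (u v : ℂ) (r : ℝ) : MvPolynomial (Fin 3) ℂ :=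
  lineForm u * lineForm v - C ((r : ℂ) ^ 2 / 4) * (X 0 ^ 2 + X 1 ^ 2)

lemma lineForm_isHomogeneous (u : ℂ) : (lineForm u).IsHomogeneous 1 :=
  IsHomogeneous.sum _ _ _ fun i _ => (isHomogeneous_X _ i).mul (isHomogeneous_C _ _)

lemma ellipseForm_isHomogeneous (u v : ℂ) (r : ℝ) : (ellipseForm u v r).IsHomogeneous 2 :=
  ((lineForm_isHomogeneous u).mul (lineForm_isHomogeneous v)).sub
    (((isHomogeneous_X_pow 0 2).add (isHomogeneous_X_pow 1 2)).C_mul _)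

lemma eval_lineForm (u : ℂ) (P : Fin 3 → ℂ) :
    eval P (lineForm u) = P 0 * u.re + P 1 * u.im + P 2 := by
  simp [lineForm, Fin.sum_univ_three]

lemma eval_ellipseForm (u v : ℂ) (r : ℝ) (P : Fin 3 → ℂ) :
    eval P (ellipseForm u v r) = (P 0 * u.re + P 1 * u.im + P 2) * (P 0 * v.re + P 1 * v.im + P 2)
      - r ^ 2 / 4 * (P 0 ^ 2 + P 1 ^ 2) := by
  simp [ellipseForm, eval_lineForm]

lemma isSymm_ext {H K : Matrix (Fin 3) (Fin 3) ℂ} (hH : H.IsSymm) (hK : K.IsSymm)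
    (h : ∀ P, dotProduct P (H.mulVec P) = dotProduct P (K.mulVec P)) : H = K := by
  have h1 : ∀ i, H i i = K i i := fun i => by
    simpa [Matrix.mulVec_single] using h (Pi.single i 1)
  ext i j
  have := h (Pi.single i 1 + Pi.single j 1)
  simp only [Matrix.mulVec_add, dotProduct_add, add_dotProduct] at this
  simp [h1, hH.apply i j, hK.apply i j] at this
  linear_combination this / 2

/-- An affine frame of the ellipse: the affine map `(X, Y) ↦ (k X + m₁, h X + l Y + m₂)` maps the
unit circle onto the ellipse with foci `(m₁ + e₁, m₂ + e₂)`, `(m₁ - e₁, m₂ - e₂)` and minor axis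
of length `r`. The lower triangular matrix with entries `k`, `h`, `l` is a Cholesky factor of `(r² / 4) I + e eᵀ`. -/
structure EllipseFrame (u v : ℂ) (r : ℝ) where
  (m₁ m₂ e₁ e₂ k h l : ℝ)
  u_re : u.re = m₁ + e₁
  u_im : u.im = m₂ + e₂
  v_re : v.re = m₁ - e₁
  v_im : v.im = m₂ - e₂
  hk : 0 < k
  hl : 0 < l
  hkk : k ^ 2 = r ^ 2 / 4 + e₁ ^ 2
  hkh : k * h = e₁ * e₂
  hll : h ^ 2 + l ^ 2 = r ^ 2 / 4 + e₂ ^ 2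

lemma exists_ellipseFrame (u v : ℂ) {r : ℝ} (hr : 0 < r) : Nonempty (EllipseFrame u v r) := by
  obtain ⟨u₁, u₂⟩ := u
  obtain ⟨v₁, v₂⟩ := v
  set e₁ := (u₁ - v₁) / 2
  set e₂ := (u₂ - v₂) / 2
  have hK : 0 < r ^ 2 / 4 + e₁ ^ 2 := by positivity
  set k := √(r ^ 2 / 4 + e₁ ^ 2)
  have hk0 : 0 < k := Real.sqrt_pos.2 hK
  have hkk : k ^ 2 = r ^ 2 / 4 + e₁ ^ 2 := Real.sq_sqrt hK.le
  have hL : 0 < r ^ 2 / 4 + e₂ ^ 2 - (e₁ * e₂ / k) ^ 2 := by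
    rw [sub_pos, div_pow (e₁ * e₂), div_lt_iff₀ (pow_pos hk0 2), hkk]
    have : 0 < r ^ 2 / 4 * (r ^ 2 / 4 + e₁ ^ 2 + e₂ ^ 2) := by positivity
    linarith
  refine ⟨⟨(u₁ + v₁) / 2, (u₂ + v₂) / 2, e₁, e₂, k, e₁ * e₂ / k,
    √(r ^ 2 / 4 + e₂ ^ 2 - (e₁ * e₂ / k) ^ 2), ?_, ?_, ?_, ?_, hk0, Real.sqrt_pos.2 hL, hkk, ?_, ?_⟩⟩
  iterate 4 · simp only [e₁, e₂]; ring
  · field_simp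
  · rw [Real.sq_sqrt hL.le]
    ring

namespace EllipseFrame

variable {u v : ℂ} {r : ℝ} (F : EllipseFrame u v r)

/-- The affine map of the frame. -/
def point (x y : ℝ) : ℂ := ⟨F.k * x + F.m₁, F.h * x + F.l * y + F.m₂⟩

lemma exists_point (ζ : ℂ) : ∃ x y, ζ = F.point x y := by
  have := F.hk.ne'
  have := F.hl.ne'
  refine ⟨(ζ.re - F.m₁) / F.k, (ζ.im - F.m₂ - F.h * ((ζ.re - F.m₁) / F.k)) / F.l, ?_⟩
  apply Complex.ext
  · simp only [point]
    field_simp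
    ring
  · simp only [point]
    field_simp
    ring

lemma point_mem_ellipseSet (hr : 0 < r) (x y : ℝ) :
    F.point x y ∈ ellipseSet u v r ↔ x ^ 2 + y ^ 2 = 1 := by
  have hk := F.hk
  have hl := F.hl
  have hkk := F.hkk
  have hkh := F.hkh
  have hll := F.hll
  have hsq : ∀ a b : ℂ, dist a b ^ 2 = (a.re - b.re) ^ 2 + (a.im - b.im) ^ 2 := fun a b => by
    rw [Complex.dist_eq, Complex.sq_norm, Complex.normSq_apply]
    simp
    ring
  have h1 := hsq (F.point x y) u
  have h2 := hsq (F.point x y) v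
  have h3 := hsq u v
  have hle : |dist (F.point x y) u - dist (F.point x y) v| ≤ dist u v := by
    rw [dist_comm _ u, dist_comm _ v]
    exact abs_dist_sub_le _ _ _
  change dist (F.point x y) u + dist (F.point x y) v = √(r ^ 2 + dist u v ^ 2) ↔ _
  have hd1 : 0 ≤ dist (F.point x y) u := dist_nonneg
  have hd2 : 0 ≤ dist (F.point x y) v := dist_nonneg
  generalize dist (F.point x y) u = d₁ at *
  generalize dist (F.point x y) v = d₂ at *
  have hc : 0 ≤ dist u v := dist_nonneg
  generalize dist u v = c at *
  have hM : √(r ^ 2 + c ^ 2) ^ 2 = r ^ 2 + c ^ 2 := Real.sq_sqrt (by positivity)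
  have hM0 : 0 ≤ √(r ^ 2 + c ^ 2) := Real.sqrt_nonneg _
  generalize √(r ^ 2 + c ^ 2) = M at *
  have hF : 0 < M ^ 2 - (d₁ - d₂) ^ 2 := by
    have : (d₁ - d₂) ^ 2 ≤ c ^ 2 := sq_le_sq' (by linarith [abs_le.1 hle]) (abs_le.1 hle).2
    nlinarith
  simp only [F.u_re, F.u_im, F.v_re, F.v_im, point] at h1 h2 h3
  generalize F.m₁ = m₁ at *
  generalize F.m₂ = m₂ at *
  generalize F.e₁ = e₁ at *
  generalize F.e₂ = e₂ at *
  generalize F.k = k at *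
  generalize F.h = h at *
  generalize F.l = l at *
  -- The product of the conjugates of `M - d₁ - d₂` is a polynomial in `d₁ ^ 2` and `d₂ ^ 2`.
  have key : (M ^ 2 - (d₁ + d₂) ^ 2) * (M ^ 2 - (d₁ - d₂) ^ 2) =
      16 * k ^ 2 * l ^ 2 * (1 - x ^ 2 - y ^ 2) := by
    have e1 : (M ^ 2 - (d₁ + d₂) ^ 2) * (M ^ 2 - (d₁ - d₂) ^ 2) =
        (M ^ 2) ^ 2 - 2 * M ^ 2 * (d₁ ^ 2 + d₂ ^ 2) + (d₁ ^ 2 - d₂ ^ 2) ^ 2 := by ring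
    have hMM : M ^ 2 = 4 * (k ^ 2 + e₂ ^ 2) := by
      rw [hM, h3]
      linear_combination (-4) * hkk
    rw [e1, hMM, h1, h2]
    have R2 : h ^ 2 + l ^ 2 - (k ^ 2 - e₁ ^ 2 + e₂ ^ 2) = 0 := by linear_combination hll - hkk
    linear_combination 16 * (-k ^ 2 * (1 - x ^ 2)) * R2
      + 16 * (k * h + e₁ * e₂ - 2 * k * h * x ^ 2 - 2 * l * k * x * y) * hkh
  have hkl : 0 < 16 * k ^ 2 * l ^ 2 := by positivity
  constructor
  · intro h'
    rw [h', sub_self, zero_mul] at key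
    have := (mul_eq_zero.1 key.symm).resolve_left hkl.ne'
    linarith
  · intro h'
    have h0 : (1 - x ^ 2 - y ^ 2) = 0 := by linarith
    rw [h0, mul_zero] at key
    have := (mul_eq_zero.1 key).resolve_right hF.ne'
    have := (sq_eq_sq₀ hM0 (add_nonneg hd1 hd2)).1 (by linarith)
    exact this.symm

/-- The matrix of the affine map of the frame, in homogeneous coordinates. -/
def toMatrix : Matrix (Fin 3) (Fin 3) ℂ :=
  !![(F.k : ℂ), 0, F.m₁; (F.h : ℂ), F.l, F.m₂; 0, 0, 1]

/-- The matrix of the quadratic form `-x² - y² + z²`, the homogeneous equation of the unit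
circle. -/
def lightcone : Matrix (Fin 3) (Fin 3) ℂ := Matrix.diagonal ![-1, -1, 1]

lemma lightcone_mul_self : lightcone * lightcone = 1 := by
  rw [lightcone, Matrix.diagonal_mul_diagonal, ← Matrix.diagonal_one]
  congr 1
  ext i
  fin_cases i <;> simp

lemma isUnit_det_toMatrix : IsUnit F.toMatrix.det := by
  rw [isUnit_iff_ne_zero, toMatrix, Matrix.det_fin_three]
  simp [F.hk.ne', F.hl.ne']

lemma toMatrix_mulVec (x y : ℝ) :
    F.toMatrix.mulVec ![(x : ℂ), y, 1] = ![((F.point x y).re : ℂ), ((F.point x y).im : ℂ), 1] := by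
  ext i
  fin_cases i <;> simp [toMatrix, point, Matrix.mulVec, dotProduct, Fin.sum_univ_three]

/-- In the coordinates of the frame, the ellipse form is `z² - x² - y²`. -/
lemma two_mul_eval_ellipseForm (P : Fin 3 → ℂ) :
    2 * eval P (ellipseForm u v r) =
      dotProduct P (((2 : ℂ) • (F.toMatrix * lightcone * F.toMatrix.transpose)).mulVec P) := by
  have hkk : (F.k : ℂ) ^ 2 = r ^ 2 / 4 + F.e₁ ^ 2 := by exact_mod_cast F.hkk
  have hkh : (F.k : ℂ) * F.h = F.e₁ * F.e₂ := by exact_mod_cast F.hkh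
  have hll : (F.h : ℂ) ^ 2 + F.l ^ 2 = r ^ 2 / 4 + F.e₂ ^ 2 := by exact_mod_cast F.hll
  rw [Matrix.smul_mulVec, dotProduct_smul, ← Matrix.mulVec_mulVec, ← Matrix.mulVec_mulVec,
    Matrix.dotProduct_mulVec, ← Matrix.mulVec_transpose, eval_ellipseForm]
  rw [F.u_re, F.u_im, F.v_re, F.v_im]
  simp [toMatrix, lightcone, Matrix.mulVec, dotProduct, Fin.sum_univ_three, Matrix.diagonal,
    Matrix.transpose_apply]
  linear_combination (P 0) ^ 2 * hkk + 2 * P 0 * P 1 * hkh + (P 1) ^ 2 * hll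

/-- The Hessian of the ellipse form, see `eval_pderiv_ellipseForm`. -/
def hessian : Matrix (Fin 3) (Fin 3) ℂ :=
  (2 : ℂ) • (F.toMatrix * lightcone * F.toMatrix.transpose)

lemma hessian_isSymm : F.hessian.IsSymm := by
  rw [Matrix.IsSymm, hessian, Matrix.transpose_smul, Matrix.transpose_mul, Matrix.transpose_mul,
    Matrix.transpose_transpose, lightcone, Matrix.diagonal_transpose, Matrix.mul_assoc]

lemma eval_pderiv_ellipseForm (P : Fin 3 → ℂ) (i : Fin 3) :
    eval P (pderiv i (ellipseForm u v r)) = (F.hessian.mulVec P) i := by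
  obtain ⟨H, hH, hgrad, heval⟩ := exists_hessian (ellipseForm_isHomogeneous u v r)
  have : H = F.hessian := isSymm_ext hH F.hessian_isSymm fun P => by
    rw [← heval, F.two_mul_eval_ellipseForm, hessian]
  rw [← this, hgrad]

lemma isUnit_det_lightcone : IsUnit lightcone.det := by
  simp [lightcone, Fin.prod_univ_three]

lemma isUnit_det_hessian : IsUnit F.hessian.det := by
  rw [hessian, Matrix.det_smul, Matrix.det_mul, Matrix.det_mul, Matrix.det_transpose]
  exact ((isUnit_iff_ne_zero.2 (by norm_num)).mul
    ((F.isUnit_det_toMatrix.mul isUnit_det_lightcone).mul F.isUnit_det_toMatrix))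

lemma hessian_inv_quadratic (η : Fin 3 → ℂ) :
    dotProduct (F.toMatrix.mulVec η) (F.hessian⁻¹.mulVec (F.toMatrix.mulVec η)) =
      dotProduct η (lightcone.mulVec η) / 2 := by
  have hG := F.isUnit_det_toMatrix
  have hT : IsUnit F.toMatrix.transpose.det := by rwa [Matrix.det_transpose]
  -- `η' = G⁻ᵀ D η / 2` solves `H η' = G η`.
  have h1 : F.hessian.mulVec
      ((1 / 2 : ℂ) • (F.toMatrix.transpose⁻¹).mulVec (lightcone.mulVec η)) = F.toMatrix.mulVec η := by
    rw [hessian, Matrix.smul_mulVec, Matrix.mulVec_smul, smul_smul, Matrix.mulVec_mulVec,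
      Matrix.mulVec_mulVec, Matrix.mul_nonsing_inv_cancel_right _ _ hT,
      Matrix.mul_assoc, lightcone_mul_self, Matrix.mul_one]
    norm_num
  have h2 : F.hessian⁻¹.mulVec (F.toMatrix.mulVec η) =
      (1 / 2 : ℂ) • (F.toMatrix.transpose⁻¹).mulVec (lightcone.mulVec η) := by
    rw [← h1, Matrix.mulVec_mulVec, Matrix.nonsing_inv_mul _ F.isUnit_det_hessian,
      Matrix.one_mulVec]
  rw [h2, dotProduct_smul, Matrix.mulVec_mulVec, Matrix.dotProduct_mulVec,
    ← Matrix.mulVec_transpose, Matrix.transpose_mul, Matrix.mulVec_mulVec, Matrix.mul_assoc,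
    Matrix.transpose_nonsing_inv, Matrix.transpose_transpose, Matrix.nonsing_inv_mul _ hG,
    Matrix.mul_one, lightcone, Matrix.diagonal_transpose, dotProduct_comm, smul_eq_mul]
  ring

lemma realDual_ellipseForm (hr : 0 < r) : realDual (ellipseForm u v r) = ellipseSet u v r := by
  obtain ⟨F⟩ := exists_ellipseFrame u v hr
  ext ζ
  obtain ⟨x, y, rfl⟩ := F.exists_point ζ
  rw [F.point_mem_ellipseSet hr]
  change _ ∈ dualCurve _ ↔ _
  rw [mem_dualCurve_quadric F.eval_pderiv_ellipseForm F.two_mul_eval_ellipseForm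
    F.isUnit_det_hessian, and_iff_right (coords_ne_zero _), ← F.toMatrix_mulVec,
    F.hessian_inv_quadratic]
  have : dotProduct ![(x : ℂ), y, 1] (lightcone.mulVec ![(x : ℂ), y, 1]) =
      ((1 - x ^ 2 - y ^ 2 : ℝ) : ℂ) := by
    simp [lightcone, Matrix.mulVec_diagonal, dotProduct, Fin.sum_univ_three]
    ring
  rw [this, div_eq_zero_iff, or_iff_left two_ne_zero, Complex.ofReal_eq_zero]
  constructor <;> intro h <;> linarith

/-- If the form were a product of two linear forms, then its gradient would vanish at a common zero
of them, but the Hessian is invertible. -/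
lemma irreducible_ellipseForm (hr : 0 < r) : Irreducible (ellipseForm u v r) := by
  obtain ⟨F⟩ := exists_ellipseFrame u v hr
  have hE0 : ellipseForm u v r ≠ 0 := by
    intro h
    have := congrArg (eval ![0, 0, 1]) h
    simp [eval_ellipseForm] at this
  have hdeg := (ellipseForm_isHomogeneous u v r).totalDegree hE0
  refine ⟨fun h => ?_, fun f g hfg => ?_⟩
  · rw [isUnit_iff_totalDegree_of_isReduced, hdeg] at h
    exact two_ne_zero h.2
  · have hfg0 : f * g ≠ 0 := hfg ▸ hE0
    have hf0 := left_ne_zero_of_mul hfg0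
    have hg0 := right_ne_zero_of_mul hfg0
    have hhom : (f * g).IsHomogeneous 2 := hfg ▸ ellipseForm_isHomogeneous u v r
    have hsum : f.totalDegree + g.totalDegree = 2 := by
      rw [← totalDegree_mul_of_isDomain hf0 hg0, ← hfg, hdeg]
    by_cases hf : f.totalDegree = 0
    · exact Or.inl (isUnit_of_totalDegree_eq_zero hf0 hf)
    by_cases hg : g.totalDegree = 0
    · exact Or.inr (isUnit_of_totalDegree_eq_zero hg0 hg)
    exfalso
    have hf1 := isHomogeneous_of_mul hhom hfg0
    have hg1 := isHomogeneous_of_mul (mul_comm f g ▸ hhom) (mul_comm f g ▸ hfg0)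
    rw [show f.totalDegree = 1 by omega] at hf1
    rw [show g.totalDegree = 1 by omega] at hg1
    obtain ⟨c, rfl⟩ := exists_eq_sum_of_isHomogeneous_one hf1
    obtain ⟨d, rfl⟩ := exists_eq_sum_of_isHomogeneous_one hg1
    obtain ⟨P, hP, hzero⟩ := (Matrix.exists_mulVec_eq_zero_iff (M := Matrix.of ![c, d, 0])).2
      (Matrix.det_eq_zero_of_row_eq_zero 2 fun j => by simp)
    have hc : eval P (∑ i, X i * C (c i)) = 0 := by
      simpa [Matrix.mulVec, dotProduct, mul_comm] using congrFun hzero 0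
    have hd : eval P (∑ i, X i * C (d i)) = 0 := by
      simpa [Matrix.mulVec, dotProduct, mul_comm] using congrFun hzero 1
    have hHP : F.hessian.mulVec P = 0 := by
      ext i
      rw [← F.eval_pderiv_ellipseForm, hfg, pderiv_mul, map_add, map_mul, map_mul, hc, hd]
      simp
    have := Matrix.nonsing_inv_mul _ F.isUnit_det_hessian
    apply hP
    rw [← Matrix.one_mulVec P, ← this, ← Matrix.mulVec_mulVec, hHP, Matrix.mulVec_zero]

/-- A conic through five points of the unit circle is the unit circle. -/
lemma eq_smul_lightcone {N : Matrix (Fin 3) (Fin 3) ℂ} (hN : N.IsSymm)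
    (h : ∀ x y : ℝ, x ^ 2 + y ^ 2 = 1 →
      dotProduct ![(x : ℂ), y, 1] (N.mulVec ![(x : ℂ), y, 1]) = 0) :
    N = N 2 2 • lightcone := by
  have e1 := h 1 0 (by norm_num)
  have e2 := h (-1) 0 (by norm_num)
  have e3 := h 0 1 (by norm_num)
  have e4 := h 0 (-1) (by norm_num)
  have e5 := h (3 / 5) (4 / 5) (by norm_num)
  simp [Matrix.mulVec, dotProduct, Fin.sum_univ_three, hN.apply 0 1, hN.apply 0 2,
    hN.apply 1 2] at e1 e2 e3 e4 e5
  have f02 : N 0 2 = 0 := by linear_combination (e1 - e2) / 4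
  have f12 : N 1 2 = 0 := by linear_combination (e3 - e4) / 4
  have f00 : N 0 0 = -N 2 2 := by linear_combination (e1 + e2) / 2
  have f11 : N 1 1 = -N 2 2 := by linear_combination (e3 + e4) / 2
  have f01 : N 0 1 = 0 := by
    linear_combination 25 / 24 * e5 - 9 / 24 * f00 - 16 / 24 * f11 - 5 / 4 * f02 - 5 / 3 * f12
  ext i j
  fin_cases i <;> fin_cases j <;>
    simp [lightcone, f00, f11, f01, f02, f12, hN.apply 0 1, hN.apply 0 2, hN.apply 1 2]

lemma associated_ellipseForm (hr : 0 < r) {f : MvPolynomial (Fin 3) ℂ} (hf : f.IsHomogeneous 2)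
    (h : realDual f = ellipseSet u v r) : Associated f (ellipseForm u v r) := by
  obtain ⟨F⟩ := exists_ellipseFrame u v hr
  obtain ⟨H, hH, hgrad, heval⟩ := exists_hessian hf
  have hmem : ∀ x y : ℝ, x ^ 2 + y ^ 2 = 1 →
      F.toMatrix.mulVec ![(x : ℂ), y, 1] ∈ dualCurve f := by
    intro x y hxy
    rw [F.toMatrix_mulVec]
    have h' : F.point x y ∈ realDual f := by
      rw [h]
      exact (F.point_mem_ellipseSet hr x y).2 hxy
    exact h'
  have hG := F.isUnit_det_toMatrix
  have hT : IsUnit F.toMatrix.transpose.det := by rwa [Matrix.det_transpose]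
  -- If `H` had a kernel, the ellipse would lie on a line.
  have hdet : IsUnit H.det := by
    rw [isUnit_iff_ne_zero]
    intro h0
    obtain ⟨κ, hκ, hHκ⟩ := Matrix.exists_mulVec_eq_zero_iff.2 h0
    have hz : ∀ x y : ℝ, x ^ 2 + y ^ 2 = 1 →
        dotProduct (F.toMatrix.transpose.mulVec κ) ![(x : ℂ), y, 1] = 0 := by
      intro x y hxy
      rw [Matrix.mulVec_transpose, ← Matrix.dotProduct_mulVec]
      exact dotProduct_eq_zero_of_mem_dualCurve hH hgrad hHκ (hmem x y hxy)
    apply hκ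
    have hzero : F.toMatrix.transpose.mulVec κ = 0 := by
      generalize F.toMatrix.transpose.mulVec κ = n at hz
      have e1 := hz 1 0 (by norm_num)
      have e2 := hz (-1) 0 (by norm_num)
      have e3 := hz 0 1 (by norm_num)
      simp [dotProduct, Fin.sum_univ_three] at e1 e2 e3
      ext i
      fin_cases i
      · simp only [Fin.zero_eta, Pi.zero_apply]
        linear_combination (e1 - e2) / 2
      · simp only [Fin.mk_one, Pi.zero_apply]
        linear_combination e3 - (e1 + e2) / 2
      · simp only [Fin.reduceFinMk, Pi.zero_apply]
        linear_combination (e1 + e2) / 2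
    rw [← Matrix.one_mulVec κ, ← Matrix.nonsing_inv_mul _ hT, ← Matrix.mulVec_mulVec, hzero,
      Matrix.mulVec_zero]
  have hHinv : H⁻¹.IsSymm := by rw [Matrix.IsSymm, Matrix.transpose_nonsing_inv, hH.eq]
  set N := F.toMatrix.transpose * H⁻¹ * F.toMatrix with hNdef
  have hN : N.IsSymm := by
    rw [Matrix.IsSymm, hNdef, Matrix.transpose_mul, Matrix.transpose_mul,
      Matrix.transpose_transpose, hHinv.eq, Matrix.mul_assoc]
  have hNc : N = N 2 2 • lightcone := by
    refine eq_smul_lightcone hN fun x y hxy => ?_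
    have := ((mem_dualCurve_quadric hgrad heval hdet _).1 (hmem x y hxy)).2
    rw [hNdef, ← Matrix.mulVec_mulVec, ← Matrix.mulVec_mulVec, Matrix.dotProduct_mulVec,
      ← Matrix.mulVec_transpose, Matrix.transpose_transpose]
    exact this
  generalize N 2 2 = c at hNc
  have hc : c ≠ 0 := by
    rintro rfl
    have : IsUnit N.det := by
      rw [hNdef, Matrix.det_mul, Matrix.det_mul]
      exact (hT.mul (by rw [Matrix.det_nonsing_inv]; exact hdet.ringInverse)).mul hG
    rw [hNc, zero_smul, Matrix.det_zero] at this
    simp at this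
  have hprod : F.toMatrix * lightcone * F.toMatrix.transpose = c • H := by
    have h1 : F.toMatrix * lightcone * N = c • F.toMatrix := by
      rw [hNc, Matrix.mul_smul, Matrix.mul_assoc, lightcone_mul_self, Matrix.mul_one]
    have h2 : F.toMatrix * lightcone * F.toMatrix.transpose * H⁻¹ * F.toMatrix =
        c • F.toMatrix := by
      rw [← h1, hNdef]
      simp only [Matrix.mul_assoc]
    have h3 : F.toMatrix * lightcone * F.toMatrix.transpose * H⁻¹ = c • 1 := by
      rw [← Matrix.mul_nonsing_inv_cancel_right F.toMatrix
        (F.toMatrix * lightcone * F.toMatrix.transpose * H⁻¹) hG, h2, Matrix.smul_mul,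
        Matrix.mul_nonsing_inv _ hG]
    rw [← Matrix.nonsing_inv_mul_cancel_right H
      (F.toMatrix * lightcone * F.toMatrix.transpose) hdet, h3, Matrix.smul_mul, Matrix.one_mul]
  refine associated_of_eval_eq (c := 2 * c) (mul_ne_zero two_ne_zero hc) fun P => ?_
  have h1 := F.two_mul_eval_ellipseForm P
  rw [hprod, Matrix.smul_mulVec, Matrix.smul_mulVec, dotProduct_smul, dotProduct_smul, ← heval,
    smul_eq_mul, smul_eq_mul] at h1
  linear_combination h1 / 2

end EllipseFrame

end Ellipses

/-! ### Kippenhahn polynomials and their factors -/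

section Factors

open MvPolynomial

lemma lineForm_ne_zero (u : ℂ) : lineForm u ≠ 0 := by
  intro h
  have := congrArg (eval ![0, 0, 1]) h
  simp [eval_lineForm] at this

lemma ellipseForm_ne_zero (u v : ℂ) (r : ℝ) : ellipseForm u v r ≠ 0 := by
  intro h
  have := congrArg (eval ![0, 0, 1]) h
  simp [eval_ellipseForm] at this

lemma irreducible_lineForm (u : ℂ) : Irreducible (lineForm u) := by
  have hdeg := (lineForm_isHomogeneous u).totalDegree (lineForm_ne_zero u)
  refine ⟨fun h => ?_, fun f g hfg => ?_⟩
  · rw [isUnit_iff_totalDegree_of_isReduced, hdeg] at h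
    exact one_ne_zero h.2
  · have h0 : f * g ≠ 0 := hfg ▸ lineForm_ne_zero u
    rw [hfg, totalDegree_mul_of_isDomain (left_ne_zero_of_mul h0) (right_ne_zero_of_mul h0)] at hdeg
    by_cases hf : f.totalDegree = 0
    · exact Or.inl (isUnit_of_totalDegree_eq_zero (left_ne_zero_of_mul h0) hf)
    · exact Or.inr (isUnit_of_totalDegree_eq_zero (right_ne_zero_of_mul h0) (by omega))

lemma totalDegree_multiset_prod_eq {s : Multiset (MvPolynomial (Fin 3) ℂ)} (h : ∀ f ∈ s, f ≠ 0) :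
    s.prod.totalDegree = (s.map totalDegree).sum := by
  induction s using Multiset.induction_on with
  | empty => simp
  | cons f s ih =>
    have hs : ∀ g ∈ s, g ≠ 0 := fun g hg => h g (Multiset.mem_cons_of_mem hg)
    rw [Multiset.prod_cons, totalDegree_mul_of_isDomain (h f (Multiset.mem_cons_self f s))
      (fun h0 => hs 0 (Multiset.prod_eq_zero_iff.1 h0) rfl), ih hs, Multiset.map_cons,
      Multiset.sum_cons]

lemma associated_prod_of_rel {M : Type*} [CommMonoid M] {s t : Multiset M}
    (h : Multiset.Rel Associated s t) : Associated s.prod t.prod := by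
  rw [← Associates.mk_eq_mk_iff_associated, ← Associates.prod_mk, ← Associates.prod_mk,
    Associates.rel_associated_iff_map_eq_map.1 h]

/-- If the degree of each member of `s` is at least that of the corresponding member of `t`, then
the same holds for the sums of the degrees; if the sums agree, so do the degrees, member by
member. -/
lemma rel_and_degree_eq {α β : Type*} {R : α → β → Prop} {a : α → ℕ} {b : β → ℕ}
    {s : Multiset α} {t : Multiset β} (h : Multiset.Rel R s t) (hR : ∀ x y, R x y → b y ≤ a x) :
    (t.map b).sum ≤ (s.map a).sum ∧
      ((s.map a).sum ≤ (t.map b).sum → Multiset.Rel (fun x y => R x y ∧ a x = b y) s t) := by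
  induction h with
  | zero => exact ⟨le_rfl, fun _ => Multiset.Rel.zero⟩
  | @cons x y s t hxy _ ih =>
    have := hR x y hxy
    simp only [Multiset.map_cons, Multiset.sum_cons]
    exact ⟨by omega, fun hle => Multiset.Rel.cons ⟨hxy, by omega⟩ (ih.2 (by omega))⟩

/-- Among the irreducible forms with the same real dual as `g`, the form `g` has the least degree,
and it is the only one of this degree, up to constants. -/
def DeterminedByDual (g : MvPolynomial (Fin 3) ℂ) : Prop :=
  ∀ f : MvPolynomial (Fin 3) ℂ, Irreducible f → f.IsHomogeneous f.totalDegree →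
    realDual f = realDual g →
      g.totalDegree ≤ f.totalDegree ∧ (f.totalDegree = g.totalDegree → Associated f g)

lemma totalDegree_pos_of_irreducible {f : MvPolynomial (Fin 3) ℂ} (hf : Irreducible f) :
    0 < f.totalDegree :=
  Nat.pos_of_ne_zero fun h => hf.not_isUnit (isUnit_of_totalDegree_eq_zero hf.ne_zero h)

lemma determinedByDual_lineForm (u : ℂ) : DeterminedByDual (lineForm u) := by
  intro f hf hhom h
  rw [(lineForm_isHomogeneous u).totalDegree (lineForm_ne_zero u)]
  refine ⟨totalDegree_pos_of_irreducible hf, fun hd => ?_⟩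
  rw [hd] at hhom
  refine associated_lineForm hhom hf.ne_zero ?_
  rw [h, realDual_lineForm]
  rfl

lemma determinedByDual_ellipseForm (u v : ℂ) {r : ℝ} (hr : 0 < r) :
    DeterminedByDual (ellipseForm u v r) := by
  intro f hf hhom h
  rw [EllipseFrame.realDual_ellipseForm hr] at h
  rw [(ellipseForm_isHomogeneous u v r).totalDegree (ellipseForm_ne_zero u v r)]
  have hpos := totalDegree_pos_of_irreducible hf
  refine ⟨?_, fun hd => ?_⟩
  · by_contra hlt
    rw [show f.totalDegree = 1 by omega] at hhom
    have hsub := realDual_subsingleton_of_isHomogeneous_one hhom hf.ne_zero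
    rw [h] at hsub
    obtain ⟨F⟩ := exists_ellipseFrame u v hr
    have := hsub ((F.point_mem_ellipseSet hr 1 0).2 (by norm_num))
      ((F.point_mem_ellipseSet hr (-1) 0).2 (by norm_num))
    have := congrArg Complex.re this
    simp only [EllipseFrame.point] at this
    linarith [F.hk]
  · rw [hd] at hhom
    exact EllipseFrame.associated_ellipseForm hr hhom h

open scoped Classical in
/-- The irreducible factors of the ellipse form. -/
noncomputable def ellipseFactors (u v : ℂ) (r : ℝ) : Multiset (MvPolynomial (Fin 3) ℂ) :=
  if r = 0 then {lineForm u, lineForm v} else {ellipseForm u v r}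

lemma prod_ellipseFactors (u v : ℂ) (r : ℝ) : (ellipseFactors u v r).prod = ellipseForm u v r := by
  rw [ellipseFactors]
  split_ifs with h
  · simp [h, ellipseForm]
  · simp

lemma map_realDual_ellipseFactors (u v : ℂ) {r : ℝ} (hr : 0 ≤ r) :
    (ellipseFactors u v r).map realDual = ellipseCurve u v r := by
  rw [ellipseFactors, ellipseCurve]
  split_ifs with h
  · simp [realDual_lineForm]
  · simp [EllipseFrame.realDual_ellipseForm (hr.lt_of_ne' h)]

lemma mem_ellipseFactors {u v : ℂ} {r : ℝ} (hr : 0 ≤ r) {g : MvPolynomial (Fin 3) ℂ}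
    (hg : g ∈ ellipseFactors u v r) : Irreducible g ∧ DeterminedByDual g := by
  rw [ellipseFactors] at hg
  split_ifs at hg with h
  · simp only [Multiset.insert_eq_cons, Multiset.mem_cons, Multiset.mem_singleton] at hg
    rcases hg with rfl | rfl <;> exact ⟨irreducible_lineForm _, determinedByDual_lineForm _⟩
  · rw [Multiset.mem_singleton.1 hg]
    have hr' := hr.lt_of_ne' h
    exact ⟨EllipseFrame.irreducible_ellipseForm hr', determinedByDual_ellipseForm u v hr'⟩

lemma kippenhahnPoly_isHomogeneous {n : ℕ} (A : Matrix (Fin n) (Fin n) ℂ) :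
    (kippenhahnPoly A).IsHomogeneous n := by
  rw [kippenhahnPoly, Matrix.det_apply']
  refine IsHomogeneous.sum _ _ _ fun σ _ => ?_
  have hprod : ∀ M : Matrix (Fin n) (Fin n) (MvPolynomial (Fin 3) ℂ),
      (∀ i j, (M i j).IsHomogeneous 1) → (∏ i, M (σ i) i).IsHomogeneous n := fun M hM => by
    simpa using IsHomogeneous.prod Finset.univ (fun i => M (σ i) i) (fun _ => 1)
      fun i _ => hM _ _
  rw [← map_intCast (C : ℂ →+* MvPolynomial (Fin 3) ℂ)]
  refine IsHomogeneous.C_mul (hprod _ fun i j => ?_) _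
  simp only [Matrix.add_apply, Matrix.smul_apply, Matrix.map_apply, smul_eq_mul]
  refine ((((isHomogeneous_X _ 0).mul (isHomogeneous_C _ _))).add
    ((isHomogeneous_X _ 1).mul (isHomogeneous_C _ _))).add ?_
  by_cases h : i = j
  · subst h
    simpa using isHomogeneous_X ℂ (2 : Fin 3)
  · simpa [h] using isHomogeneous_zero (Fin 3) ℂ 1

/-- In the coordinates `a = (x - i y) / 2`, `b = (x + i y) / 2`, the pencil of `Re A` and `Im A`
becomes the pencil of `A` and its adjoint. -/
lemma eval_kippenhahnPoly {n : ℕ} (A : Matrix (Fin n) (Fin n) ℂ) (a b z : ℂ) :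
    eval ![a + b, Complex.I * (a - b), z] (kippenhahnPoly A) =
      (a • A + b • A.conjTranspose + z • (1 : Matrix (Fin n) (Fin n) ℂ)).det := by
  rw [kippenhahnPoly, RingHom.map_det]
  congr 1
  ext i j
  by_cases h : i = j
  · subst h
    simp
    linear_combination -(a - b) / 2 * (A i i - conj (A i i)) * Complex.I_mul_I
  · simp [h]
    linear_combination -(a - b) / 2 * (A i j - conj (A j i)) * Complex.I_mul_I

lemma eq_of_eval_eq {f g : MvPolynomial (Fin 3) ℂ}
    (h : ∀ a b z : ℂ, eval ![a + b, Complex.I * (a - b), z] f =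
      eval ![a + b, Complex.I * (a - b), z] g) : f = g := by
  refine MvPolynomial.funext fun P => ?_
  have := h ((P 0 - Complex.I * P 1) / 2) ((P 0 + Complex.I * P 1) / 2) (P 2)
  have hP : ![(P 0 - Complex.I * P 1) / 2 + (P 0 + Complex.I * P 1) / 2,
      Complex.I * ((P 0 - Complex.I * P 1) / 2 - (P 0 + Complex.I * P 1) / 2), P 2] = P := by
    ext i
    fin_cases i
    · simp
      ring
    · simp
      linear_combination (-P 1) * Complex.I_mul_I
    · simp
  rwa [hP] at this

/-- The Kippenhahn curve consists of the given components if and only if the Kippenhahn polynomial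
is the product of the corresponding forms. -/
theorem kippenhahnCurve_eq_iff (A : Matrix (Fin 5) (Fin 5) ℂ) (u₁ v₁ u₂ v₂ u : ℂ) {r s : ℝ}
    (hr : 0 ≤ r) (hs : 0 ≤ s) :
    kippenhahnCurve A = ellipseCurve u₁ v₁ r + ellipseCurve u₂ v₂ s + pointCurve u ↔
      kippenhahnPoly A = ellipseForm u₁ v₁ r * ellipseForm u₂ v₂ s * lineForm u := by
  set t : Multiset (MvPolynomial (Fin 3) ℂ) :=
    ellipseFactors u₁ v₁ r + ellipseFactors u₂ v₂ s + {lineForm u} with ht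
  have hcurve : ellipseCurve u₁ v₁ r + ellipseCurve u₂ v₂ s + pointCurve u = t.map realDual := by
    simp [ht, map_realDual_ellipseFactors _ _ hr, map_realDual_ellipseFactors _ _ hs, pointCurve,
      realDual_lineForm]
  have hprod : ellipseForm u₁ v₁ r * ellipseForm u₂ v₂ s * lineForm u = t.prod := by
    simp [ht, prod_ellipseFactors]
  have hmem : ∀ g ∈ t, Irreducible g ∧ DeterminedByDual g := by
    intro g hg
    rw [ht, Multiset.mem_add, Multiset.mem_add, Multiset.mem_singleton] at hg
    rcases hg with (hg | hg) | rfl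
    · exact mem_ellipseFactors hr hg
    · exact mem_ellipseFactors hs hg
    · exact ⟨irreducible_lineForm u, determinedByDual_lineForm u⟩
  have hA1 : eval ![0, 0, 1] (kippenhahnPoly A) = 1 := by
    simpa using eval_kippenhahnPoly A 0 0 1
  have hA0 : kippenhahnPoly A ≠ 0 := fun h => by simp [h] at hA1
  have ht1 : eval ![0, 0, 1] t.prod = 1 := by
    rw [← hprod]
    simp [eval_ellipseForm, eval_lineForm]
  have ht0 : t.prod ≠ 0 := fun h => by simp [h] at ht1
  have hAssoc := UniqueFactorizationMonoid.factors_prod hA0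
  have hirr : ∀ f ∈ UniqueFactorizationMonoid.factors (kippenhahnPoly A), Irreducible f :=
    UniqueFactorizationMonoid.irreducible_of_factor
  rw [hcurve, hprod, kippenhahnCurve]
  constructor
  · intro h
    rw [← Multiset.rel_eq, Multiset.rel_map] at h
    have hhom : ∀ f ∈ UniqueFactorizationMonoid.factors (kippenhahnPoly A),
        f.IsHomogeneous f.totalDegree := by
      intro f hf
      obtain ⟨g, hg⟩ := UniqueFactorizationMonoid.dvd_of_mem_factors hf
      exact isHomogeneous_of_mul (hg ▸ kippenhahnPoly_isHomogeneous A) (hg ▸ hA0)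
    have h1 := h.mono (p := fun f g => Irreducible f ∧ f.IsHomogeneous f.totalDegree ∧
        DeterminedByDual g ∧ realDual f = realDual g)
      fun f hf g hg hfg => ⟨hirr f hf, hhom f hf, (hmem g hg).2, hfg⟩
    have h2 := (rel_and_degree_eq (a := totalDegree) (b := totalDegree) h1
      fun f g hfg => (hfg.2.2.1 f hfg.1 hfg.2.1 hfg.2.2.2).1).2 ?_
    · have h3 : Multiset.Rel Associated (UniqueFactorizationMonoid.factors (kippenhahnPoly A)) t :=
        h2.mono fun f _ g _ hfg =>
          (hfg.1.2.2.1 f hfg.1.1 hfg.1.2.1 hfg.1.2.2.2).2 hfg.2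
      -- Associated polynomials with the same value `1` at `(0, 0, 1)` agree.
      obtain ⟨c, hc⟩ := hAssoc.symm.trans (associated_prod_of_rel h3)
      obtain ⟨d, -, hd⟩ := isUnit_iff_eq_C_of_isReduced.1 c.isUnit
      have h4 := congrArg (eval ![0, 0, 1]) hc
      rw [map_mul, hA1, ht1, hd, eval_C, one_mul] at h4
      rw [← hc, hd, h4, C_1, mul_one]
    · rw [← totalDegree_multiset_prod_eq fun f hf => (hirr f hf).ne_zero,
        ← totalDegree_multiset_prod_eq fun f hf => (hmem f hf).1.ne_zero]
      have h5 : t.prod.totalDegree = 5 := by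
        rw [← hprod]
        exact (((ellipseForm_isHomogeneous _ _ _).mul (ellipseForm_isHomogeneous _ _ _)).mul
          (lineForm_isHomogeneous _)).totalDegree (hprod ▸ ht0)
      rw [h5]
      exact (totalDegree_le_of_dvd_of_isDomain hAssoc.dvd hA0).trans
        (kippenhahnPoly_isHomogeneous A).totalDegree_le
  · intro h
    rw [← Multiset.rel_eq, Multiset.rel_map]
    exact (UniqueFactorizationMonoid.factors_unique hirr (fun g hg => (hmem g hg).1)
      (h ▸ hAssoc)).mono fun f _ g _ hfg => realDual_eq_of_associated hfg

/-- The equation `p_A = T` in the coordinates `a`, `b` of `eval_kippenhahnPoly`. -/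
theorem kippenhahnPoly_eq_iff {n : ℕ} (A : Matrix (Fin n) (Fin n) ℂ) (u₁ v₁ u₂ v₂ u : ℂ)
    (r s : ℝ) :
    kippenhahnPoly A = ellipseForm u₁ v₁ r * ellipseForm u₂ v₂ s * lineForm u ↔
      ∀ a b z : ℂ, (a • A + b • A.conjTranspose + z • (1 : Matrix (Fin n) (Fin n) ℂ)).det =
        ((z + a * u₁ + b * conj u₁) * (z + a * v₁ + b * conj v₁) - (r : ℂ) ^ 2 * (a * b)) *
        ((z + a * u₂ + b * conj u₂) * (z + a * v₂ + b * conj v₂) - (s : ℂ) ^ 2 * (a * b)) *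
        (z + a * u + b * conj u) := by
  have hline : ∀ a b z u : ℂ, (a + b) * u.re + Complex.I * (a - b) * u.im + z =
      z + a * u + b * conj u := by
    intro a b z u
    have h1 := Complex.re_add_im u
    have h2 : (u.re : ℂ) - u.im * Complex.I = conj u := Complex.ext (by simp) (by simp)
    linear_combination a * h1 + b * h2
  have hT : ∀ a b z : ℂ, eval ![a + b, Complex.I * (a - b), z]
      (ellipseForm u₁ v₁ r * ellipseForm u₂ v₂ s * lineForm u) =
        ((z + a * u₁ + b * conj u₁) * (z + a * v₁ + b * conj v₁) - (r : ℂ) ^ 2 * (a * b)) *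
        ((z + a * u₂ + b * conj u₂) * (z + a * v₂ + b * conj v₂) - (s : ℂ) ^ 2 * (a * b)) *
        (z + a * u + b * conj u) := by
    intro a b z
    have hsq : (a + b) ^ 2 + (Complex.I * (a - b)) ^ 2 = 4 * (a * b) := by
      linear_combination (a - b) ^ 2 * Complex.I_mul_I
    simp only [map_mul, eval_ellipseForm, eval_lineForm, Matrix.cons_val_zero, Matrix.cons_val_one,
      Matrix.cons_val, hline, hsq]
    ring
  constructor
  · intro h a b z
    rw [← eval_kippenhahnPoly, h, hT]
  · intro h
    refine eq_of_eval_eq fun a b z => ?_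
    rw [eval_kippenhahnPoly, h, hT]

end Factors


/-! ### The index sets -/

lemma sum_S_ijk_lm {M : Type*} [AddCommMonoid M]
    (f : Fin 5 × Fin 5 × Fin 5 × Fin 5 × Fin 5 → M) :
    ∑ x ∈ S_ijk_lm, f x =
      f (0, 1, 2, 3, 4) + f (0, 1, 3, 2, 4) + f (0, 1, 4, 2, 3) + f (0, 2, 3, 1, 4) +
      f (0, 2, 4, 1, 3) + f (0, 3, 4, 1, 2) + f (1, 2, 3, 0, 4) + f (1, 2, 4, 0, 3) +
      f (1, 3, 4, 0, 2) + f (2, 3, 4, 0, 1) := by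
  have h : S_ijk_lm =
      {(0, 1, 2, 3, 4), (0, 1, 3, 2, 4), (0, 1, 4, 2, 3), (0, 2, 3, 1, 4), (0, 2, 4, 1, 3),
      (0, 3, 4, 1, 2), (1, 2, 3, 0, 4), (1, 2, 4, 0, 3), (1, 3, 4, 0, 2), (2, 3, 4, 0, 1)} := by
    decide +kernel
  rw [h]
  iterate 9 rw [Finset.sum_insert (by decide)]
  rw [Finset.sum_singleton]
  simp only [add_assoc]

lemma sum_S_ij_klm {M : Type*} [AddCommMonoid M]
    (f : Fin 5 × Fin 5 × Fin 5 × Fin 5 × Fin 5 → M) :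
    ∑ x ∈ S_ij_klm, f x =
      f (0, 1, 2, 3, 4) + f (0, 2, 1, 3, 4) + f (0, 3, 1, 2, 4) + f (0, 4, 1, 2, 3) +
      f (1, 2, 0, 3, 4) + f (1, 3, 0, 2, 4) + f (1, 4, 0, 2, 3) + f (2, 3, 0, 1, 4) +
      f (2, 4, 0, 1, 3) + f (3, 4, 0, 1, 2) := by
  have h : S_ij_klm =
      {(0, 1, 2, 3, 4), (0, 2, 1, 3, 4), (0, 3, 1, 2, 4), (0, 4, 1, 2, 3), (1, 2, 0, 3, 4),
      (1, 3, 0, 2, 4), (1, 4, 0, 2, 3), (2, 3, 0, 1, 4), (2, 4, 0, 1, 3), (3, 4, 0, 1, 2)} := by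
    decide +kernel
  rw [h]
  iterate 9 rw [Finset.sum_insert (by decide)]
  rw [Finset.sum_singleton]
  simp only [add_assoc]

lemma sum_S_i_jklm {M : Type*} [AddCommMonoid M]
    (f : Fin 5 × Fin 5 × Fin 5 × Fin 5 × Fin 5 → M) :
    ∑ x ∈ S_i_jklm, f x =
      f (0, 1, 2, 3, 4) + f (1, 0, 2, 3, 4) + f (2, 0, 1, 3, 4) + f (3, 0, 1, 2, 4) +
      f (4, 0, 1, 2, 3) := by
  have h : S_i_jklm =
      {(0, 1, 2, 3, 4), (1, 0, 2, 3, 4), (2, 0, 1, 3, 4), (3, 0, 1, 2, 4), (4, 0, 1, 2, 3)} := by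
    decide +kernel
  rw [h]
  iterate 4 rw [Finset.sum_insert (by decide)]
  rw [Finset.sum_singleton]
  simp only [add_assoc]

lemma sum_S_ijkl_iml {M : Type*} [AddCommMonoid M]
    (f : Fin 5 × Fin 5 × Fin 5 × Fin 5 × Fin 5 → M) :
    ∑ x ∈ S_ijkl_iml, f x =
      f (0, 1, 2, 4, 3) + f (0, 1, 3, 4, 2) + f (0, 2, 3, 4, 1) := by
  have h : S_ijkl_iml =
      {(0, 1, 2, 4, 3), (0, 1, 3, 4, 2), (0, 2, 3, 4, 1)} := by
    decide +kernel
  rw [h]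
  iterate 2 rw [Finset.sum_insert (by decide)]
  rw [Finset.sum_singleton]
  simp only [add_assoc]

lemma sum_S_ijk_lm_im_lk {M : Type*} [AddCommMonoid M]
    (f : Fin 5 × Fin 5 × Fin 5 × Fin 5 × Fin 5 → M) :
    ∑ x ∈ S_ijk_lm_im_lk, f x =
      f (0, 1, 3, 2, 4) + f (0, 1, 4, 2, 3) + f (0, 2, 3, 1, 4) + f (0, 2, 4, 1, 3) +
      f (0, 3, 4, 1, 2) + f (1, 2, 3, 0, 4) + f (1, 2, 4, 0, 3) + f (1, 3, 4, 0, 2) := by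
  have h : S_ijk_lm_im_lk =
      {(0, 1, 3, 2, 4), (0, 1, 4, 2, 3), (0, 2, 3, 1, 4), (0, 2, 4, 1, 3), (0, 3, 4, 1, 2),
      (1, 2, 3, 0, 4), (1, 2, 4, 0, 3), (1, 3, 4, 0, 2)} := by
    decide +kernel
  rw [h]
  iterate 7 rw [Finset.sum_insert (by decide)]
  rw [Finset.sum_singleton]
  simp only [add_assoc]

lemma sum_S_lm {M : Type*} [AddCommMonoid M]
    (f : Fin 5 × Fin 5 → M) :
    ∑ x ∈ S_lm, f x =
      f (0, 1) + f (0, 2) + f (0, 3) + f (0, 4) + f (1, 2) + f (1, 3) + f (1, 4) + f (2, 3) +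
      f (2, 4) + f (3, 4) := by
  have h : S_lm =
      {(0, 1), (0, 2), (0, 3), (0, 4), (1, 2), (1, 3), (1, 4), (2, 3), (2, 4), (3, 4)} := by
    decide +kernel
  rw [h]
  iterate 9 rw [Finset.sum_insert (by decide)]
  rw [Finset.sum_singleton]
  simp only [add_assoc]

lemma sum_S_klm {M : Type*} [AddCommMonoid M]
    (f : Fin 5 × Fin 5 × Fin 5 → M) :
    ∑ x ∈ S_klm, f x =
      f (0, 1, 2) + f (0, 1, 3) + f (0, 1, 4) + f (0, 2, 3) + f (0, 2, 4) + f (0, 3, 4) +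
      f (1, 2, 3) + f (1, 2, 4) + f (1, 3, 4) + f (2, 3, 4) := by
  have h : S_klm =
      {(0, 1, 2), (0, 1, 3), (0, 1, 4), (0, 2, 3), (0, 2, 4), (0, 3, 4), (1, 2, 3), (1, 2, 4),
      (1, 3, 4), (2, 3, 4)} := by
    decide +kernel
  rw [h]
  iterate 9 rw [Finset.sum_insert (by decide)]
  rw [Finset.sum_singleton]
  simp only [add_assoc]

lemma sum_S_jklm {M : Type*} [AddCommMonoid M]
    (f : Fin 5 × Fin 5 × Fin 5 × Fin 5 → M) :
    ∑ x ∈ S_jklm, f x =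
      f (0, 1, 2, 3) + f (0, 1, 2, 4) + f (0, 1, 3, 4) + f (0, 2, 3, 4) + f (1, 2, 3, 4) := by
  have h : S_jklm =
      {(0, 1, 2, 3), (0, 1, 2, 4), (0, 1, 3, 4), (0, 2, 3, 4), (1, 2, 3, 4)} := by
    decide +kernel
  rw [h]
  iterate 4 rw [Finset.sum_insert (by decide)]
  rw [Finset.sum_singleton]
  simp only [add_assoc]

/-- As `i.succAbove` is the increasing enumeration of the indices other than `i`, the same index
patterns occur for every `i`; likewise in the next two lemmas. -/
lemma sum_S_jkm_lm {M : Type*} [AddCommMonoid M] (i : Fin 5)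
    (f : Fin 5 × Fin 5 × Fin 5 × Fin 5 → M) :
    ∑ x ∈ S_jkm_lm i, f x =
      f (i.succAbove 0, i.succAbove 1, i.succAbove 2, i.succAbove 3) +
      f (i.succAbove 0, i.succAbove 2, i.succAbove 1, i.succAbove 3) +
      f (i.succAbove 1, i.succAbove 2, i.succAbove 0, i.succAbove 3) := by
  have h : S_jkm_lm i =
      {(i.succAbove 0, i.succAbove 1, i.succAbove 2, i.succAbove 3),
      (i.succAbove 0, i.succAbove 2, i.succAbove 1, i.succAbove 3),
      (i.succAbove 1, i.succAbove 2, i.succAbove 0, i.succAbove 3)} := by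
    revert i
    decide +kernel
  rw [h]
  iterate 2 rw [Finset.sum_insert (by revert i; decide +kernel)]
  rw [Finset.sum_singleton]
  simp only [add_assoc]

lemma sum_S_jkl_jml {M : Type*} [AddCommMonoid M] (i : Fin 5)
    (f : Fin 5 × Fin 5 × Fin 5 × Fin 5 → M) :
    ∑ x ∈ S_jkl_jml i, f x =
      f (i.succAbove 0, i.succAbove 1, i.succAbove 3, i.succAbove 2) +
      f (i.succAbove 0, i.succAbove 2, i.succAbove 3, i.succAbove 1) := by
  have h : S_jkl_jml i =
      {(i.succAbove 0, i.succAbove 1, i.succAbove 3, i.succAbove 2),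
      (i.succAbove 0, i.succAbove 2, i.succAbove 3, i.succAbove 1)} := by
    revert i
    decide +kernel
  rw [h]
  iterate 1 rw [Finset.sum_insert (by revert i; decide +kernel)]
  rw [Finset.sum_singleton]

lemma sum_S_jk_lkm {M : Type*} [AddCommMonoid M] (i : Fin 5)
    (f : Fin 5 × Fin 5 × Fin 5 × Fin 5 → M) :
    ∑ x ∈ S_jk_lkm i, f x =
      f (i.succAbove 0, i.succAbove 2, i.succAbove 1, i.succAbove 3) +
      f (i.succAbove 1, i.succAbove 2, i.succAbove 0, i.succAbove 3) := by
  have h : S_jk_lkm i =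
      {(i.succAbove 0, i.succAbove 2, i.succAbove 1, i.succAbove 3),
      (i.succAbove 1, i.succAbove 2, i.succAbove 0, i.succAbove 3)} := by
    revert i
    decide +kernel
  rw [h]
  iterate 1 rw [Finset.sum_insert (by revert i; decide +kernel)]
  rw [Finset.sum_singleton]

/-! ### The determinant of the pencil -/

section Coefficients

variable (a b : Fin 5 → Fin 5 → ℂ) (l m : Fin 5 → ℂ)

/-- The contribution to the determinant of the permutations of the four indices other than `i` that
have no fixed point and as many ascents as descents: three pairs of disjoint transpositions and four
`4`-cycles. Here `a j k`, for `j < k`, stands for the entry above the diagonal and `b j k` for the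
one below it. For `b = conj a` this is `entryP`, see `ofReal_entryP`. -/
noncomputable def cyclePairSum (i : Fin 5) : ℂ :=
  (∑ ⟨j, k, n, o⟩ ∈ S_jkm_lm i, a j k * b j k * (a n o * b n o))
    - (∑ ⟨j, k, n, o⟩ ∈ S_jkl_jml i, a j k * a k n * b j o * b o n)
    - ∑ ⟨j, k, n, o⟩ ∈ S_jk_lkm i, a j k * a n o * b j o * b n k

/-- The coefficient in `det_pencil` of `z³`. -/
noncomputable def cofactor003 : ℂ := -∑ ⟨j, k⟩ ∈ S_lm, a j k * b j k

/-- The coefficient in `det_pencil` of `x z²`; that of `y z²` results from exchanging `a` with `b` and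
`l` with `m`, and likewise for the other coefficients. -/
noncomputable def cofactor102 : ℂ :=
  -(∑ ⟨i, j, k, n, o⟩ ∈ S_ijk_lm, a n o * b n o * (l i + l j + l k))
    + ∑ ⟨k, n, o⟩ ∈ S_klm, a k n * a n o * b k o

/-- The coefficient in `det_pencil` of `x² z`. -/
noncomputable def cofactor201 : ℂ :=
  -(∑ ⟨i, j, k, n, o⟩ ∈ S_ijk_lm, a n o * b n o * (l i * l j + l i * l k + l j * l k))
    + (∑ ⟨i, j, k, n, o⟩ ∈ S_ij_klm, (l i + l j) * (a k n * a n o * b k o))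
    - ∑ ⟨j, k, n, o⟩ ∈ S_jklm, a j k * a k n * a n o * b j o

/-- The coefficient in `det_pencil` of `x y z`. -/
noncomputable def cofactor111 : ℂ :=
  -(∑ ⟨i, j, k, n, o⟩ ∈ S_ijk_lm, a n o * b n o *
      (l i * m j + m i * l j + l i * m k + m i * l k + l j * m k + m j * l k))
    + (∑ ⟨i, j, k, n, o⟩ ∈ S_ij_klm,
        ((m i + m j) * (a k n * a n o * b k o) + (l i + l j) * (b k n * b n o * a k o)))
    + ∑ i, cyclePairSum a b i

/-- The coefficient in `det_pencil` of `x³`. -/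
noncomputable def cofactor300 : ℂ :=
  -(∑ ⟨i, j, k, n, o⟩ ∈ S_ijk_lm, a n o * b n o * (l i * l j * l k))
    + (∑ ⟨i, j, k, n, o⟩ ∈ S_ij_klm, l i * l j * (a k n * a n o * b k o))
    - (∑ ⟨i, j, k, n, o⟩ ∈ S_i_jklm, a j k * a k n * a n o * b j o * l i)
    + a 0 1 * a 1 2 * a 2 3 * a 3 4 * b 0 4

/-- The coefficient in `det_pencil` of `x² y`. -/
noncomputable def cofactor210 : ℂ :=
  -(∑ ⟨i, j, k, n, o⟩ ∈ S_ijk_lm, a n o * b n o *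
      (l i * l j * m k + l i * m j * l k + m i * l j * l k))
    + (∑ ⟨i, j, k, n, o⟩ ∈ S_ij_klm, ((l i * m j + m i * l j) * (a k n * a n o * b k o)
        + l i * l j * (b k n * b n o * a k o)))
    + (∑ i, cyclePairSum a b i * l i)
    - (∑ ⟨i, j, k, n, o⟩ ∈ S_i_jklm, a j k * a k n * a n o * b j o * m i)
    - (∑ ⟨i, j, k, n, o⟩ ∈ S_ij_klm, a k n * a n o * b k o * (a i j * b i j))
    + (∑ ⟨i, j, k, n, o⟩ ∈ S_ijkl_iml, a i j * a j k * a k n * b i o * b o n)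
    + ∑ ⟨i, j, k, n, o⟩ ∈ S_ijk_lm_im_lk, a i j * a j k * a n o * b i o * b n k

lemma det_fin_four_expand {R : Type*} [CommRing R] (A : Matrix (Fin 4) (Fin 4) R) :
    A.det = A 0 0 * (A.submatrix (Fin.succAbove 0) (Fin.succAbove 0)).det
     - A 0 1 * (A.submatrix (Fin.succAbove 0) (Fin.succAbove 1)).det
     + A 0 2 * (A.submatrix (Fin.succAbove 0) (Fin.succAbove 2)).det
     - A 0 3 * (A.submatrix (Fin.succAbove 0) (Fin.succAbove 3)).det := by
  rw [Matrix.det_succ_row_zero, Fin.sum_univ_four]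
  simp [Fin.succAbove_zero]
  ring


set_option maxHeartbeats 4000000 in
/-- The determinant of the matrix with diagonal entries `z + x l i + y m i`, entries `x a i j` above
the diagonal and `y b i j` below it. -/
theorem det_pencil (x y z : ℂ) (M : Matrix (Fin 5) (Fin 5) ℂ)
    (hd : ∀ i, M i i = z + x * l i + y * m i) (hu : ∀ i j, i < j → M i j = x * a i j)
    (hl : ∀ i j, i < j → M j i = y * b i j) :
    M.det = (∏ i, (z + x * l i + y * m i)) + x * y * (cofactor003 a b * z ^ 3
      + (cofactor102 a b l * x + cofactor102 b a m * y) * z ^ 2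
      + (cofactor201 a b l * x ^ 2 + cofactor111 a b l m * x * y + cofactor201 b a m * y ^ 2) * z
      + (cofactor300 a b l * x ^ 3 + cofactor210 a b l m * x ^ 2 * y
        + cofactor210 b a m l * x * y ^ 2 + cofactor300 b a m * y ^ 3)) := by
  rw [Matrix.det_succ_row_zero, Fin.sum_univ_five]
  simp only [det_fin_four_expand, Matrix.det_fin_three, Matrix.submatrix_apply]
  simp [Fin.succAbove, Fin.lt_def]
  rw [hu 0 1 (by decide), hu 0 2 (by decide), hu 0 3 (by decide), hu 0 4 (by decide),
    hu 1 2 (by decide), hu 1 3 (by decide), hu 1 4 (by decide), hu 2 3 (by decide),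
    hu 2 4 (by decide), hu 3 4 (by decide), hl 0 1 (by decide), hl 0 2 (by decide),
    hl 0 3 (by decide), hl 0 4 (by decide), hl 1 2 (by decide), hl 1 3 (by decide),
    hl 1 4 (by decide), hl 2 3 (by decide), hl 2 4 (by decide), hl 3 4 (by decide),
    hd 0, hd 1, hd 2, hd 3, hd 4, Fin.prod_univ_five]
  simp only [cofactor003, cofactor102, cofactor201, cofactor111, cofactor300, cofactor210,
    cyclePairSum, sum_S_ijk_lm, sum_S_ij_klm, sum_S_i_jklm, sum_S_ijkl_iml, sum_S_ijk_lm_im_lk,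
    sum_S_lm, sum_S_klm, sum_S_jklm, sum_S_jkm_lm, sum_S_jkl_jml, sum_S_jk_lkm,
    Fin.sum_univ_five]
  simp [Fin.succAbove, Fin.lt_def]
  ring

end Coefficients

/-! ### Complex forms of the conditions -/

section RealForms

variable (A : Matrix (Fin 5) (Fin 5) ℂ)

lemma ofReal_entryP (i : Fin 5) :
    (entryP A i : ℂ) = cyclePairSum (fun i j => A i j) (fun i j => conj (A i j)) i := by
  simp only [entryP, cyclePairSum, sum_S_jkm_lm, sum_S_jkl_jml, sum_S_jk_lkm]
  push_cast
  simp only [Complex.re_eq_add_conj, ← Complex.mul_conj', map_mul, Complex.conj_conj]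
  ring

lemma norm_sq_eq_mul_conj (u : ℂ) : ((‖u‖ : ℝ) : ℂ) ^ 2 = u * conj u :=
  (Complex.mul_conj' u).symm

lemma ofReal_im_eq (u : ℂ) : ((u.im : ℝ) : ℂ) = -Complex.I / 2 * (u - conj u) := by
  rw [Complex.sub_conj]
  push_cast
  linear_combination (u.im : ℂ) * Complex.I_mul_I

lemma ofReal_im_mul_ofReal_im (u v : ℂ) :
    ((u.im : ℝ) : ℂ) * ((v.im : ℝ) : ℂ) = -(u - conj u) * (v - conj v) / 4 := by
  rw [Complex.sub_conj, Complex.sub_conj]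
  push_cast
  linear_combination (u.im : ℂ) * (v.im : ℂ) * Complex.I_mul_I

variable (l : Fin 5 → ℂ)

set_option maxHeartbeats 4000000 in
lemma ofReal_alpha_cubic :
    (((∑ ⟨i, j, k, l', m⟩ ∈ S_ijk_lm, ‖A l' m‖ ^ 2 * ((l i).re * (l j).re * (l k).re))
          - (∑ ⟨i, j, k, l', m⟩ ∈ S_ij_klm,
              (A k l' * A l' m * conj (A k m)).re * ((l i).re * (l j).re))
          - 1 / 4 * (∑ i, entryP A i * (l i).re)
          + 1 / 2 * (∑ ⟨i, j, k, l', m⟩ ∈ S_i_jklm,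
              (A j k * A k l' * A l' m * conj (A j m)).re * (l i).re)
          + 1 / 4 * (∑ ⟨i, j, k, l', m⟩ ∈ S_ij_klm,
              (A k l' * A l' m * conj (A k m)).re * ‖A i j‖ ^ 2)
          - 1 / 4 * (∑ ⟨i, j, k, l', m⟩ ∈ S_ijkl_iml,
              (A i j * A j k * A k l' * conj (A i m) * conj (A m l')).re)
          - 1 / 4 * (∑ ⟨i, j, k, l', m⟩ ∈ S_ijk_lm_im_lk,
              (A i j * A j k * A l' m * conj (A i m) * conj (A l' k)).re)
          - 1 / 4 * (A 0 1 * A 1 2 * A 2 3 * A 3 4 * conj (A 0 4)).re : ℝ) : ℂ) =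
    -(cofactor300 (fun i j => A i j) (fun i j => conj (A i j)) l
      + cofactor210 (fun i j => A i j) (fun i j => conj (A i j)) l (fun i => conj (l i))
      + cofactor210 (fun i j => conj (A i j)) (fun i j => A i j) (fun i => conj (l i)) l
      + cofactor300 (fun i j => conj (A i j)) (fun i j => A i j) (fun i => conj (l i))) / 8 := by
  simp only [cofactor300, cofactor210, sum_S_ijk_lm, sum_S_ij_klm, sum_S_i_jklm,
    sum_S_ijkl_iml, sum_S_ijk_lm_im_lk, Fin.sum_univ_five]
  push_cast
  simp only [ofReal_entryP]
  simp only [cyclePairSum, sum_S_jkm_lm, sum_S_jkl_jml, sum_S_jk_lkm]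
  simp only [Complex.re_eq_add_conj, norm_sq_eq_mul_conj, map_mul, Complex.conj_conj]
  simp [Fin.succAbove, Fin.lt_def]
  ring

set_option maxHeartbeats 4000000 in
lemma ofReal_beta_cubic :
    (((∑ ⟨i, j, k, l', m⟩ ∈ S_ijk_lm, ‖A l' m‖ ^ 2 * ((l i).im * (l j).im * (l k).im))
          - (∑ ⟨i, j, k, l', m⟩ ∈ S_ij_klm,
              (A k l' * A l' m * conj (A k m)).im * ((l i).im * (l j).im))
          - 1 / 4 * (∑ i, entryP A i * (l i).im)
          - 1 / 2 * (∑ ⟨i, j, k, l', m⟩ ∈ S_i_jklm,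
              (A j k * A k l' * A l' m * conj (A j m)).re * (l i).im)
          + 1 / 4 * (∑ ⟨i, j, k, l', m⟩ ∈ S_ij_klm,
              (A k l' * A l' m * conj (A k m)).im * ‖A i j‖ ^ 2)
          - 1 / 4 * (∑ ⟨i, j, k, l', m⟩ ∈ S_ijkl_iml,
              (A i j * A j k * A k l' * conj (A i m) * conj (A m l')).im)
          - 1 / 4 * (∑ ⟨i, j, k, l', m⟩ ∈ S_ijk_lm_im_lk,
              (A i j * A j k * A l' m * conj (A i m) * conj (A l' k)).im)
          + 1 / 4 * (A 0 1 * A 1 2 * A 2 3 * A 3 4 * conj (A 0 4)).im : ℝ) : ℂ) =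
    -Complex.I * (cofactor300 (fun i j => A i j) (fun i j => conj (A i j)) l
      - cofactor210 (fun i j => A i j) (fun i j => conj (A i j)) l (fun i => conj (l i))
      + cofactor210 (fun i j => conj (A i j)) (fun i j => A i j) (fun i => conj (l i)) l
      - cofactor300 (fun i j => conj (A i j)) (fun i j => A i j) (fun i => conj (l i))) / 8 := by
  simp only [cofactor300, cofactor210, sum_S_ijk_lm, sum_S_ij_klm, sum_S_i_jklm,
    sum_S_ijkl_iml, sum_S_ijk_lm_im_lk, Fin.sum_univ_five]
  push_cast
  simp only [ofReal_entryP]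
  simp only [cyclePairSum, sum_S_jkm_lm, sum_S_jkl_jml, sum_S_jk_lkm]
  -- Products of two imaginary parts are replaced first, so that `I` occurs only linearly.
  simp only [ofReal_im_mul_ofReal_im]
  simp only [ofReal_im_eq, Complex.re_eq_add_conj, norm_sq_eq_mul_conj, map_mul,
    Complex.conj_conj]
  simp [Fin.succAbove, Fin.lt_def]
  ring

set_option maxHeartbeats 4000000 in
lemma ofReal_alpha_quadratic :
    (((∑ ⟨i, j, k, l', m⟩ ∈ S_ijk_lm, ‖A l' m‖ ^ 2 *
            ((l i).re * (l j).re + (l i).re * (l k).re + (l j).re * (l k).re))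
          - (∑ ⟨i, j, k, l', m⟩ ∈ S_ij_klm,
              (A k l' * A l' m * conj (A k m)).re * ((l i).re + (l j).re))
          - 1 / 4 * (∑ i, entryP A i)
          + 1 / 2 * (∑ ⟨j, k, l', m⟩ ∈ S_jklm,
              (A j k * A k l' * A l' m * conj (A j m)).re) : ℝ) : ℂ) =
    -(cofactor201 (fun i j => A i j) (fun i j => conj (A i j)) l
      + cofactor111 (fun i j => A i j) (fun i j => conj (A i j)) l (fun i => conj (l i))
      + cofactor201 (fun i j => conj (A i j)) (fun i j => A i j) (fun i => conj (l i))) / 4 := by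
  simp only [cofactor201, cofactor111, sum_S_ijk_lm, sum_S_ij_klm, sum_S_jklm,
    Fin.sum_univ_five]
  push_cast
  simp only [ofReal_entryP]
  simp only [cyclePairSum, sum_S_jkm_lm, sum_S_jkl_jml, sum_S_jk_lkm]
  simp only [Complex.re_eq_add_conj, norm_sq_eq_mul_conj, map_mul, Complex.conj_conj]
  simp [Fin.succAbove, Fin.lt_def]
  ring

lemma conj_cofactor102 (a b : Fin 5 → Fin 5 → ℂ) :
    conj (cofactor102 a b l) =
      cofactor102 (fun i j => conj (a i j)) (fun i j => conj (b i j)) (fun i => conj (l i)) := by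
  simp [cofactor102, sum_S_ijk_lm, sum_S_klm]

lemma conj_cofactor201 (a b : Fin 5 → Fin 5 → ℂ) :
    conj (cofactor201 a b l) =
      cofactor201 (fun i j => conj (a i j)) (fun i j => conj (b i j)) (fun i => conj (l i)) := by
  simp [cofactor201, sum_S_ijk_lm, sum_S_ij_klm, sum_S_jklm]

lemma conj_cofactor300 (a b : Fin 5 → Fin 5 → ℂ) :
    conj (cofactor300 a b l) =
      cofactor300 (fun i j => conj (a i j)) (fun i j => conj (b i j)) (fun i => conj (l i)) := by
  simp [cofactor300, sum_S_ijk_lm, sum_S_ij_klm, sum_S_i_jklm]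

lemma ofReal_sum_norm_sq :
    ((∑ ⟨l', m⟩ ∈ S_lm, ‖A l' m‖ ^ 2 : ℝ) : ℂ) =
      -cofactor003 (fun i j => A i j) (fun i j => conj (A i j)) := by
  simp [cofactor003, sum_S_lm, norm_sq_eq_mul_conj]

lemma lambda_linear_eq :
    (∑ ⟨i, j, k, l', m⟩ ∈ S_ijk_lm, (‖A l' m‖ : ℂ) ^ 2 * (l i + l j + l k))
          - ∑ ⟨k, l', m⟩ ∈ S_klm, A k l' * A l' m * conj (A k m) =
      -cofactor102 (fun i j => A i j) (fun i j => conj (A i j)) l := by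
  simp only [cofactor102, norm_sq_eq_mul_conj]
  ring

lemma lambda_quadratic_eq :
    (∑ ⟨i, j, k, l', m⟩ ∈ S_ijk_lm,
            (‖A l' m‖ : ℂ) ^ 2 * (l i * l j + l i * l k + l j * l k))
          - (∑ ⟨i, j, k, l', m⟩ ∈ S_ij_klm, (l i + l j) * (A k l' * A l' m * conj (A k m)))
          + ∑ ⟨j, k, l', m⟩ ∈ S_jklm, A j k * A k l' * A l' m * conj (A j m) =
      -cofactor201 (fun i j => A i j) (fun i j => conj (A i j)) l := by
  simp only [cofactor201, norm_sq_eq_mul_conj]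
  ring

lemma lambda_cubic_eq :
    (∑ ⟨i, j, k, l', m⟩ ∈ S_ijk_lm, (‖A l' m‖ : ℂ) ^ 2 * (l i * l j * l k))
          - (∑ ⟨i, j, k, l', m⟩ ∈ S_ij_klm, l i * l j * (A k l' * A l' m * conj (A k m)))
          + (∑ ⟨i, j, k, l', m⟩ ∈ S_i_jklm, A j k * A k l' * A l' m * conj (A j m) * l i)
          - A 0 1 * A 1 2 * A 2 3 * A 3 4 * conj (A 0 4) =
      -cofactor300 (fun i j => A i j) (fun i j => conj (A i j)) l := by
  simp only [cofactor300, norm_sq_eq_mul_conj]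
  ring

end RealForms

/-! ### Comparison of coefficients -/

/-- A cubic form vanishing off the coordinate lines `x = 0` and `y = 0` is zero; its coefficients are
recovered by interpolation at ten points. -/
lemma cubic_coeffs_eq_zero (c003 c102 c012 c201 c111 c021 c300 c210 c120 c030 : ℂ) :
    (∀ x y z : ℂ, x * y * (c003 * z ^ 3 + (c102 * x + c012 * y) * z ^ 2
      + (c201 * x ^ 2 + c111 * x * y + c021 * y ^ 2) * z
      + (c300 * x ^ 3 + c210 * x ^ 2 * y + c120 * x * y ^ 2 + c030 * y ^ 3)) = 0) ↔
    c003 = 0 ∧ c102 = 0 ∧ c012 = 0 ∧ c201 = 0 ∧ c111 = 0 ∧ c021 = 0 ∧ c300 = 0 ∧ c210 = 0 ∧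
      c120 = 0 ∧ c030 = 0 := by
  constructor
  · intro h
    have e0 := h 1 1 0
    have e1 := h 1 1 1
    have e2 := h 1 1 (-1)
    have e3 := h 1 1 2
    have e4 := h 1 (-1) 0
    have e5 := h 1 (-1) 1
    have e6 := h 1 (-1) (-1)
    have e7 := h 1 2 0
    have e8 := h 1 2 1
    have e9 := h 1 (-2) 0
    refine ⟨?_, ?_, ?_, ?_, ?_, ?_, ?_, ?_, ?_, ?_⟩
    · linear_combination (1 / 2) * e0 - (1 / 2) * e1 - (1 / 6) * e2 + (1 / 6) * e3
    · linear_combination (-1 / 2) * e0 + (1 / 4) * e1 + (1 / 4) * e2 + (1 / 2) * e4 - (1 / 4) * e5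
        + (-1 / 4) * e6
    · linear_combination (-1 / 2) * e0 + (1 / 4) * e1 + (1 / 4) * e2 - (1 / 2) * e4 + (1 / 4) * e5
        + (1 / 4) * e6
    · linear_combination (-1) * e0 + (5 / 4) * e1 - (1 / 12) * e2 - (1 / 6) * e3 - (1 / 6) * e4
        + (-1 / 12) * e5 + (1 / 4) * e6 + (1 / 6) * e7 - (1 / 6) * e8
    · linear_combination (1 / 4) * e1 - (1 / 4) * e2 + (1 / 4) * e5 - (1 / 4) * e6
    · linear_combination (1 / 2) * e0 - (1 / 2) * e1 + (1 / 6) * e4 - (1 / 6) * e5 - (1 / 6) * e7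
        + (1 / 6) * e8
    · linear_combination (2 / 3) * e0 - (2 / 3) * e4 - (1 / 12) * e7 + (1 / 12) * e9
    · linear_combination (2 / 3) * e0 + (2 / 3) * e4 - (1 / 24) * e7 - (1 / 24) * e9
    · linear_combination (-1 / 6) * e0 + (1 / 6) * e4 + (1 / 12) * e7 - (1 / 12) * e9
    · linear_combination (-1 / 6) * e0 - (1 / 6) * e4 + (1 / 24) * e7 + (1 / 24) * e9
  · rintro ⟨rfl, rfl, rfl, rfl, rfl, rfl, rfl, rfl, rfl, rfl⟩ x y z
    ring

lemma prod_eq_of_nodup {M : Type*} [CommMonoid M] {p q t v w : Fin 5}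
    (h : [p, q, t, v, w].Nodup) (f : Fin 5 → M) :
    ∏ i, f i = f p * f q * (f t * f v) * f w := by
  have hu : ([p, q, t, v, w].toFinset : Finset (Fin 5)) = Finset.univ := by
    rw [← Finset.card_eq_iff_eq_univ, List.toFinset_card_of_nodup h]
    rfl
  rw [← hu, List.prod_toFinset f h]
  simp [mul_assoc]

/-- The algebraic half of the result: the seven equations compare the coefficients of
the determinant with those of the product of the forms of two ellipses and a point. -/
theorem pencil_det_eq_iff (A : Matrix (Fin 5) (Fin 5) ℂ) (hA : A.BlockTriangular id)
    (lam : Fin 5 → ℂ) (hlam : ∀ i, lam i = A i i)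
    (p q t v w : Fin 5) (hidx : [p, q, t, v, w].Nodup) (r s : ℝ) :
    (∀ x y z : ℂ, (x • A + y • A.conjTranspose + z • (1 : Matrix (Fin 5) (Fin 5) ℂ)).det =
      ((z + x * lam p + y * conj (lam p)) * (z + x * lam q + y * conj (lam q))
          - (r : ℂ) ^ 2 * (x * y)) *
      ((z + x * lam t + y * conj (lam t)) * (z + x * lam v + y * conj (lam v))
          - (s : ℂ) ^ 2 * (x * y)) * (z + x * lam w + y * conj (lam w))) ↔
      r ^ 2 + s ^ 2 = ∑ ⟨l, m⟩ ∈ S_lm, ‖A l m‖ ^ 2 ∧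
      (r : ℂ) ^ 2 * (lam w + lam t + lam v) + (s : ℂ) ^ 2 * (lam w + lam q + lam p) =
        (∑ ⟨i, j, k, l, m⟩ ∈ S_ijk_lm, (‖A l m‖ : ℂ) ^ 2 * (lam i + lam j + lam k))
          - ∑ ⟨k, l, m⟩ ∈ S_klm, A k l * A l m * conj (A k m) ∧
      (r : ℂ) ^ 2 * (lam w * lam v + lam w * lam t + lam t * lam v)
          + (s : ℂ) ^ 2 * (lam w * lam p + lam w * lam q + lam p * lam q) =
        (∑ ⟨i, j, k, l, m⟩ ∈ S_ijk_lm,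
            (‖A l m‖ : ℂ) ^ 2 * (lam i * lam j + lam i * lam k + lam j * lam k))
          - (∑ ⟨i, j, k, l, m⟩ ∈ S_ij_klm, (lam i + lam j) * (A k l * A l m * conj (A k m)))
          + ∑ ⟨j, k, l, m⟩ ∈ S_jklm, A j k * A k l * A l m * conj (A j m) ∧
      (r : ℂ) ^ 2 * (lam w * lam t * lam v) + (s : ℂ) ^ 2 * (lam w * lam p * lam q) =
        (∑ ⟨i, j, k, l, m⟩ ∈ S_ijk_lm, (‖A l m‖ : ℂ) ^ 2 * (lam i * lam j * lam k))
          - (∑ ⟨i, j, k, l, m⟩ ∈ S_ij_klm, lam i * lam j * (A k l * A l m * conj (A k m)))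
          + (∑ ⟨i, j, k, l, m⟩ ∈ S_i_jklm, A j k * A k l * A l m * conj (A j m) * lam i)
          - A 0 1 * A 1 2 * A 2 3 * A 3 4 * conj (A 0 4) ∧
      r ^ 2 * ((lam w).re * (lam t).re * (lam v).re) + s ^ 2 * ((lam w).re * (lam p).re * (lam q).re)
          - r ^ 2 * s ^ 2 / 4 * (lam w).re =
        (∑ ⟨i, j, k, l, m⟩ ∈ S_ijk_lm, ‖A l m‖ ^ 2 * ((lam i).re * (lam j).re * (lam k).re))
          - (∑ ⟨i, j, k, l, m⟩ ∈ S_ij_klm,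
              (A k l * A l m * conj (A k m)).re * ((lam i).re * (lam j).re))
          - 1 / 4 * (∑ i, entryP A i * (lam i).re)
          + 1 / 2 * (∑ ⟨i, j, k, l, m⟩ ∈ S_i_jklm,
              (A j k * A k l * A l m * conj (A j m)).re * (lam i).re)
          + 1 / 4 * (∑ ⟨i, j, k, l, m⟩ ∈ S_ij_klm,
              (A k l * A l m * conj (A k m)).re * ‖A i j‖ ^ 2)
          - 1 / 4 * (∑ ⟨i, j, k, l, m⟩ ∈ S_ijkl_iml,
              (A i j * A j k * A k l * conj (A i m) * conj (A m l)).re)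
          - 1 / 4 * (∑ ⟨i, j, k, l, m⟩ ∈ S_ijk_lm_im_lk,
              (A i j * A j k * A l m * conj (A i m) * conj (A l k)).re)
          - 1 / 4 * (A 0 1 * A 1 2 * A 2 3 * A 3 4 * conj (A 0 4)).re ∧
      r ^ 2 * ((lam w).im * (lam t).im * (lam v).im) + s ^ 2 * ((lam w).im * (lam p).im * (lam q).im)
          - r ^ 2 * s ^ 2 / 4 * (lam w).im =
        (∑ ⟨i, j, k, l, m⟩ ∈ S_ijk_lm, ‖A l m‖ ^ 2 * ((lam i).im * (lam j).im * (lam k).im))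
          - (∑ ⟨i, j, k, l, m⟩ ∈ S_ij_klm,
              (A k l * A l m * conj (A k m)).im * ((lam i).im * (lam j).im))
          - 1 / 4 * (∑ i, entryP A i * (lam i).im)
          - 1 / 2 * (∑ ⟨i, j, k, l, m⟩ ∈ S_i_jklm,
              (A j k * A k l * A l m * conj (A j m)).re * (lam i).im)
          + 1 / 4 * (∑ ⟨i, j, k, l, m⟩ ∈ S_ij_klm,
              (A k l * A l m * conj (A k m)).im * ‖A i j‖ ^ 2)
          - 1 / 4 * (∑ ⟨i, j, k, l, m⟩ ∈ S_ijkl_iml,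
              (A i j * A j k * A k l * conj (A i m) * conj (A m l)).im)
          - 1 / 4 * (∑ ⟨i, j, k, l, m⟩ ∈ S_ijk_lm_im_lk,
              (A i j * A j k * A l m * conj (A i m) * conj (A l k)).im)
          + 1 / 4 * (A 0 1 * A 1 2 * A 2 3 * A 3 4 * conj (A 0 4)).im ∧
      r ^ 2 * ((lam w).re * (lam t).re + (lam w).re * (lam v).re + (lam v).re * (lam t).re)
          + s ^ 2 * ((lam w).re * (lam p).re + (lam w).re * (lam q).re + (lam p).re * (lam q).re)
          - r ^ 2 * s ^ 2 / 4 =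
        (∑ ⟨i, j, k, l, m⟩ ∈ S_ijk_lm, ‖A l m‖ ^ 2 *
            ((lam i).re * (lam j).re + (lam i).re * (lam k).re + (lam j).re * (lam k).re))
          - (∑ ⟨i, j, k, l, m⟩ ∈ S_ij_klm,
              (A k l * A l m * conj (A k m)).re * ((lam i).re + (lam j).re))
          - 1 / 4 * (∑ i, entryP A i)
          + 1 / 2 * (∑ ⟨j, k, l, m⟩ ∈ S_jklm, (A j k * A k l * A l m * conj (A j m)).re) := by
  -- The real equations are compared over `ℂ`.
  rw [← Complex.ofReal_inj (z := r ^ 2 + s ^ 2), ofReal_sum_norm_sq, lambda_linear_eq,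
    lambda_quadratic_eq, lambda_cubic_eq, ← Complex.ofReal_inj, ofReal_alpha_cubic,
    ← Complex.ofReal_inj, ofReal_beta_cubic, ← Complex.ofReal_inj, ofReal_alpha_quadratic]
  push_cast
  -- Products of two imaginary parts are replaced first, so that `I` occurs only linearly.
  simp only [Complex.re_eq_add_conj, ofReal_im_mul_ofReal_im]
  simp only [ofReal_im_eq]
  set a : Fin 5 → Fin 5 → ℂ := fun i j => A i j with ha
  set b : Fin 5 → Fin 5 → ℂ := fun i j => conj (A i j) with hb
  set μ : Fin 5 → ℂ := fun i => conj (lam i) with hμ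
  have hdet : ∀ x y z : ℂ,
      (x • A + y • A.conjTranspose + z • (1 : Matrix (Fin 5) (Fin 5) ℂ)).det = _ := fun x y z =>
    det_pencil a b lam μ x y z _
      (fun i => by simp [hlam, hμ]; ring)
      (fun i j h => by
        simp [ha, Matrix.one_apply_ne h.ne, hA (show id i < id j from h)])
      (fun i j h => by
        simp [hb, Matrix.one_apply_ne h.ne', hA (show id i < id j from h)])
  have c102 := conj_cofactor102 lam a b
  have c201 := conj_cofactor201 lam a b
  have c300 := conj_cofactor300 lam a b
  have hba : (fun i j => conj (b i j)) = a := by ext; simp [ha, hb]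
  have hab : (fun i j => conj (a i j)) = b := rfl
  have hlm : (fun i => conj (lam i)) = μ := rfl
  rw [hba, hab, hlm] at c102 c201 c300
  simp only [hdet, prod_eq_of_nodup hidx]
  have hm : ∀ i, conj (lam i) = μ i := fun _ => rfl
  simp only [hm]
  -- The coefficients of the cubic form `Q`.
  obtain ⟨q003, e003⟩ : ∃ u, u = cofactor003 a b + (r ^ 2 + s ^ 2) := ⟨_, rfl⟩
  obtain ⟨q102, e102⟩ : ∃ u, u = cofactor102 a b lam
    + (r ^ 2 * (lam w + lam t + lam v) + s ^ 2 * (lam w + lam q + lam p)) := ⟨_, rfl⟩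
  obtain ⟨q012, e012⟩ : ∃ u, u = cofactor102 b a μ
    + (r ^ 2 * (μ w + μ t + μ v) + s ^ 2 * (μ w + μ q + μ p)) := ⟨_, rfl⟩
  obtain ⟨q201, e201⟩ : ∃ u, u = cofactor201 a b lam
    + (r ^ 2 * (lam w * lam v + lam w * lam t + lam t * lam v)
      + s ^ 2 * (lam w * lam p + lam w * lam q + lam p * lam q)) := ⟨_, rfl⟩
  obtain ⟨q111, e111⟩ : ∃ u, u = cofactor111 a b lam μ
    + (r ^ 2 * (lam w * μ v + μ w * lam v + lam w * μ t + μ w * lam t + lam t * μ v + μ t * lam v)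
      + s ^ 2 * (lam w * μ p + μ w * lam p + lam w * μ q + μ w * lam q + lam p * μ q + μ p * lam q)
      - r ^ 2 * s ^ 2) := ⟨_, rfl⟩
  obtain ⟨q021, e021⟩ : ∃ u, u = cofactor201 b a μ
    + (r ^ 2 * (μ w * μ v + μ w * μ t + μ t * μ v)
      + s ^ 2 * (μ w * μ p + μ w * μ q + μ p * μ q)) := ⟨_, rfl⟩
  obtain ⟨q300, e300⟩ : ∃ u, u = cofactor300 a b lam
    + (r ^ 2 * (lam w * lam t * lam v) + s ^ 2 * (lam w * lam p * lam q)) := ⟨_, rfl⟩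
  obtain ⟨q210, e210⟩ : ∃ u, u = cofactor210 a b lam μ
    + (r ^ 2 * (lam w * lam t * μ v + lam w * μ t * lam v + μ w * lam t * lam v)
      + s ^ 2 * (lam w * lam p * μ q + lam w * μ p * lam q + μ w * lam p * lam q)
      - r ^ 2 * s ^ 2 * lam w) := ⟨_, rfl⟩
  obtain ⟨q120, e120⟩ : ∃ u, u = cofactor210 b a μ lam
    + (r ^ 2 * (μ w * μ t * lam v + μ w * lam t * μ v + lam w * μ t * μ v)
      + s ^ 2 * (μ w * μ p * lam q + μ w * lam p * μ q + lam w * μ p * μ q)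
      - r ^ 2 * s ^ 2 * μ w) := ⟨_, rfl⟩
  obtain ⟨q030, e030⟩ : ∃ u, u = cofactor300 b a μ
    + (r ^ 2 * (μ w * μ t * μ v) + s ^ 2 * (μ w * μ p * μ q)) := ⟨_, rfl⟩
  have key := cubic_coeffs_eq_zero q003 q102 q012 q201 q111 q021 q300 q210 q120 q030
  refine Iff.trans ?_ (key.trans ?_)
  · refine forall_congr' fun x => forall_congr' fun y => forall_congr' fun z => ?_
    rw [← sub_eq_zero]
    refine Eq.congr ?_ rfl
    rw [e003, e102, e012, e201, e111, e021, e300, e210, e120, e030]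
    ring
  · constructor
    · rintro ⟨h1, h2, h3, h4, h5, h6, h7, h8, h9, h10⟩
      refine ⟨?_, ?_, ?_, ?_, ?_, ?_, ?_⟩
      · linear_combination h1 - e003
      · linear_combination h2 - e102
      · linear_combination h4 - e201
      · linear_combination h7 - e300
      · linear_combination (h7 - e300 + (h8 - e210) + (h9 - e120) + (h10 - e030)) / 8
      · linear_combination Complex.I / 8 * (h7 - e300 - (h8 - e210) + (h9 - e120) - (h10 - e030))
      · linear_combination (h4 - e201 + (h5 - e111) + (h6 - e021)) / 4
    · rintro ⟨h1, h2, h3, h4, h5, h6, h7⟩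
      have k2 := congrArg conj h2
      have k3 := congrArg conj h3
      have k4 := congrArg conj h4
      simp only [map_add, map_mul, map_neg, map_pow, Complex.conj_ofReal, c102, c201, c300,
        hm] at k2 k3 k4
      have f102 : q102 = 0 := by linear_combination h2 + e102
      have f012 : q012 = 0 := by linear_combination k2 + e012
      have f201 : q201 = 0 := by linear_combination h3 + e201
      have f021 : q021 = 0 := by linear_combination k3 + e021
      have f300 : q300 = 0 := by linear_combination h4 + e300
      have f030 : q030 = 0 := by linear_combination k4 + e030
      have g1 : q300 + q210 + q120 + q030 = 0 := by
        linear_combination 8 * h5 + e300 + e210 + e120 + e030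
      have g2 : q300 - q210 + q120 - q030 = 0 := by
        refine (mul_eq_zero.1 (?_ : Complex.I * _ = 0)).resolve_left Complex.I_ne_zero
        linear_combination 8 * h6 + Complex.I * (e300 - e210 + e120 - e030)
      refine ⟨?_, f102, f012, f201, ?_, f021, f300, ?_, ?_, f030⟩
      · linear_combination h1 + e003
      · linear_combination 4 * h7 + e111 + e201 + e021 - f201 - f021
      · linear_combination (g1 - g2) / 2 - f030
      · linear_combination (g1 + g2) / 2 - f300

theorem theorem2p2 (A : Matrix (Fin 5) (Fin 5) ℂ) (hA : A.BlockTriangular id)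
    (lam : Fin 5 → ℂ) (hlam : ∀ i, lam i = A i i)
    (α β : Fin 5 → ℝ) (hα : ∀ i, α i = (lam i).re) (hβ : ∀ i, β i = (lam i).im)
    (p q t v w : Fin 5) (hidx : [p, q, t, v, w].Nodup)
    (r s : ℝ) (hr : 0 ≤ r) (hs : 0 ≤ s) :
    kippenhahnCurve A =
        ellipseCurve (lam p) (lam q) r + ellipseCurve (lam t) (lam v) s + pointCurve (lam w) ↔
      -- (a)
      r ^ 2 + s ^ 2 = ∑ ⟨l, m⟩ ∈ S_lm, ‖A l m‖ ^ 2 ∧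
      -- (b)
      (r : ℂ) ^ 2 * (lam w + lam t + lam v) + (s : ℂ) ^ 2 * (lam w + lam q + lam p) =
        (∑ ⟨i, j, k, l, m⟩ ∈ S_ijk_lm, (‖A l m‖ : ℂ) ^ 2 * (lam i + lam j + lam k))
          - ∑ ⟨k, l, m⟩ ∈ S_klm, A k l * A l m * conj (A k m) ∧
      -- (c)
      (r : ℂ) ^ 2 * (lam w * lam v + lam w * lam t + lam t * lam v)
          + (s : ℂ) ^ 2 * (lam w * lam p + lam w * lam q + lam p * lam q) =
        (∑ ⟨i, j, k, l, m⟩ ∈ S_ijk_lm,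
            (‖A l m‖ : ℂ) ^ 2 * (lam i * lam j + lam i * lam k + lam j * lam k))
          - (∑ ⟨i, j, k, l, m⟩ ∈ S_ij_klm, (lam i + lam j) * (A k l * A l m * conj (A k m)))
          + ∑ ⟨j, k, l, m⟩ ∈ S_jklm, A j k * A k l * A l m * conj (A j m) ∧
      -- (d)
      (r : ℂ) ^ 2 * (lam w * lam t * lam v) + (s : ℂ) ^ 2 * (lam w * lam p * lam q) =
        (∑ ⟨i, j, k, l, m⟩ ∈ S_ijk_lm, (‖A l m‖ : ℂ) ^ 2 * (lam i * lam j * lam k))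
          - (∑ ⟨i, j, k, l, m⟩ ∈ S_ij_klm, lam i * lam j * (A k l * A l m * conj (A k m)))
          + (∑ ⟨i, j, k, l, m⟩ ∈ S_i_jklm, A j k * A k l * A l m * conj (A j m) * lam i)
          - A 0 1 * A 1 2 * A 2 3 * A 3 4 * conj (A 0 4) ∧
      -- (e)
      r ^ 2 * (α w * α t * α v) + s ^ 2 * (α w * α p * α q) - r ^ 2 * s ^ 2 / 4 * α w =
        (∑ ⟨i, j, k, l, m⟩ ∈ S_ijk_lm, ‖A l m‖ ^ 2 * (α i * α j * α k))
          - (∑ ⟨i, j, k, l, m⟩ ∈ S_ij_klm, (A k l * A l m * conj (A k m)).re * (α i * α j))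
          - 1 / 4 * (∑ i, entryP A i * α i)
          + 1 / 2 * (∑ ⟨i, j, k, l, m⟩ ∈ S_i_jklm,
              (A j k * A k l * A l m * conj (A j m)).re * α i)
          + 1 / 4 * (∑ ⟨i, j, k, l, m⟩ ∈ S_ij_klm,
              (A k l * A l m * conj (A k m)).re * ‖A i j‖ ^ 2)
          - 1 / 4 * (∑ ⟨i, j, k, l, m⟩ ∈ S_ijkl_iml,
              (A i j * A j k * A k l * conj (A i m) * conj (A m l)).re)
          - 1 / 4 * (∑ ⟨i, j, k, l, m⟩ ∈ S_ijk_lm_im_lk,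
              (A i j * A j k * A l m * conj (A i m) * conj (A l k)).re)
          - 1 / 4 * (A 0 1 * A 1 2 * A 2 3 * A 3 4 * conj (A 0 4)).re ∧
      -- (f)
      r ^ 2 * (β w * β t * β v) + s ^ 2 * (β w * β p * β q) - r ^ 2 * s ^ 2 / 4 * β w =
        (∑ ⟨i, j, k, l, m⟩ ∈ S_ijk_lm, ‖A l m‖ ^ 2 * (β i * β j * β k))
          - (∑ ⟨i, j, k, l, m⟩ ∈ S_ij_klm, (A k l * A l m * conj (A k m)).im * (β i * β j))
          - 1 / 4 * (∑ i, entryP A i * β i)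
          - 1 / 2 * (∑ ⟨i, j, k, l, m⟩ ∈ S_i_jklm,
              (A j k * A k l * A l m * conj (A j m)).re * β i)
          + 1 / 4 * (∑ ⟨i, j, k, l, m⟩ ∈ S_ij_klm,
              (A k l * A l m * conj (A k m)).im * ‖A i j‖ ^ 2)
          - 1 / 4 * (∑ ⟨i, j, k, l, m⟩ ∈ S_ijkl_iml,
              (A i j * A j k * A k l * conj (A i m) * conj (A m l)).im)
          - 1 / 4 * (∑ ⟨i, j, k, l, m⟩ ∈ S_ijk_lm_im_lk,
              (A i j * A j k * A l m * conj (A i m) * conj (A l k)).im)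
          + 1 / 4 * (A 0 1 * A 1 2 * A 2 3 * A 3 4 * conj (A 0 4)).im ∧
      -- (g)
      r ^ 2 * (α w * α t + α w * α v + α v * α t) + s ^ 2 * (α w * α p + α w * α q + α p * α q)
          - r ^ 2 * s ^ 2 / 4 =
        (∑ ⟨i, j, k, l, m⟩ ∈ S_ijk_lm, ‖A l m‖ ^ 2 * (α i * α j + α i * α k + α j * α k))
          - (∑ ⟨i, j, k, l, m⟩ ∈ S_ij_klm, (A k l * A l m * conj (A k m)).re * (α i + α j))
          - 1 / 4 * (∑ i, entryP A i)
          + 1 / 2 * (∑ ⟨j, k, l, m⟩ ∈ S_jklm, (A j k * A k l * A l m * conj (A j m)).re) := by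
  obtain rfl : α = fun i => (lam i).re := funext hα
  obtain rfl : β = fun i => (lam i).im := funext hβ
  rw [kippenhahnCurve_eq_iff A _ _ _ _ _ hr hs, kippenhahnPoly_eq_iff]
  exact pencil_det_eq_iff A hA lam hlam p q t v w hidx r s
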